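/- **Setting.** Let $\mathcal V$ be an $n$-fold monoidal category with products $\otimes_1,\dots,\otimes_n$, a common unit $I$ and interchangers $\eta^{ij}_{ABCD}\colon (A\otimes_j B)\otimes_i(C\otimes_j D)\to(A\otimes_i C)\otimes_j(B\otimes_i D)$ for $i<j$, subject to the internal and external unit and associativity conditions and the giant hexagon condition. (Associators and unitors may be coherent isomorphisms; the strict case, in which they are identities, is included. They are suppressed below.) Assume that $\mathcal V$ has coproducts and that all functors $-\otimes_i A$ and $A\otimes_i-$ preserve them, including the initial object $\emptyset$. Put $\eta^{pq}_{AIIB}\colon A\otimes_pB\to A\otimes_qB$ for $p<q$, and let it be the identity for $p=q$. A collection is a sequence $\mathcal C=(\mathcal C(j))_{j\ge0}$ of objects of $\mathcal V$. For $p<q$ set $$(\mathcal B\otimes^{pq}\mathcal C)(j)=\coprod_{k\ge 0,\ j_1+\dots+j_k=j}\mathcal B(k)\otimes_p(\mathcal C(j_1)\otimes_q\cdots\otimes_q\mathcal C(j_k)),$$ with unit $(\emptyset,I,\emptyset,\emptyset,\dots)$ and with the lax associator $(\mathcal A\otimes^{pq}\mathcal B)\otimes^{pq}\mathcal C\to\mathcal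 A\otimes^{pq}(\mathcal B\otimes^{pq}\mathcal C)$ induced by $\eta^{pq}$. Let $2\le m\le n$. *Condensed definition.* An $m$-fold operad is a monoid in $\mathrm{Col}_m(\mathcal V)$, that is, in collections with the product $\otimes^{(m-1)m}$. *Expanded definition.* An $m$-fold operad is a collection $\mathcal C$ with a unit $\mathcal J\colon I\to\mathcal C(1)$ and compositions $$\gamma^{pq}\colon \mathcal C(k)\otimes_p(\mathcal C(j_1)\otimes_q\cdots\otimes_q\mathcal C(j_k))\to\mathcal C(j_1+\dots+j_k)\qquad(1\le p<q\le m,\ k\ge1,\ j_s\ge0)$$ such that, for each pair $(p,q)$, the operad associativity diagram (whose rearrangement is built from $\eta^{pq}$) and the two unit diagrams commute; where a composition with $k=0$ occurs in these diagrams it is read as the canonical map $\mathcal C(0)\otimes_p I=\mathcal C(0)$. Call it *compatible* if for all $p<s\le q+1\le m$ $$\gamma^{ps}=\gamma^{q,q+1}\circ\bigl(\eta^{pq}_{AIIB}\circ(1\otimes_p\eta^{s,q+1})\bigr),$$ where $\eta^{s,q+1}$ is the map $\mathcal C(j_1)\otimes_s\cdots\otimes_s\mathcal C(j_k)\to\mathcal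 C(j_1)\otimes_{q+1}\cdots\otimes_{q+1}\mathcal C(j_k)$ built from the maps $\eta^{s,q+1}_{AIIB}$. **Theorem.** The two definitions are equivalent in the following sense. 1. For every expanded $m$-fold operad on $\mathcal C$ there is exactly one monoid structure on $\mathcal C$ in $\mathrm{Col}_m(\mathcal V)$ whose unit is $\mathcal J$ and whose multiplication has the components $\gamma^{m-1,m}$ (for $k\ge1$). 2. Every monoid structure on $\mathcal C$ in $\mathrm{Col}_m(\mathcal V)$ arises in this way from exactly one compatible expanded $m$-fold operad structure on $\mathcal C$. 3. Under this correspondence between compatible expanded $m$-fold operads and monoids, a map of collections commutes with the units and all $\gamma^{pq}$ if and only if it is a homomorphism of monoids. 4. For every monoid in $\mathrm{Col}_m(\mathcal V)$ with multiplication components $\gamma^{m-1,m}$ and all $1\le p<s\le m$, the same unit and the maps $\gamma^{ps}=\gamma^{m-1,m}\circ(\eta^{p,m-1}_{AIIB}\circ(1\otimes_p\eta^{s,m}))$ are the unit and the components of exactly one monoid structure on $\mathcal C$ for $\otimes^{ps}$. In particular, if $m\ge3$, every $m$-fold operad is an $(m-1)$-fold operad, with $\gamma^{m-2,m-1}$ built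 from $\gamma^{m-1,m}$ in this way. -/

import Mathlib

open CategoryTheory CategoryTheory.Limits

universe v u

/-- `n` tensor product functors on a category together with one common unit object. The products are
indexed by `Fin n`, so that the index `i` stands for the product number `i + 1`. -/
structure TensorData (n : ℕ) (V : Type u) [Category.{v} V] where
  unit : V
  tensor : Fin n → V ⥤ V ⥤ V

namespace TensorData

variable {n : ℕ} {V : Type u} [Category.{v} V] (T : TensorData n V)

/-- The product `A ⊗ᵢ B` of two objects. -/
abbrev ob (i : Fin n) (A B : V) : V := ((T.tensor i).obj A).obj B

/-- The product `f ⊗ᵢ g` of two morphisms. -/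
def hom (i : Fin n) {A A' B B' : V} (f : A ⟶ A') (g : B ⟶ B') : T.ob i A B ⟶ T.ob i A' B' :=
  ((T.tensor i).map f).app B ≫ ((T.tensor i).obj A').map g

end TensorData

/-- An `n`-fold monoidal category with a common unit `I`. Associators and unitors are part of the
structure; in the strict case they are identities (`eqToIso`), the unit conditions say that
`η_{ABII}`, `η_{IIAB}`, `η_{AIBI}` and `η_{IAIB}` are identities, and the pentagon and the triangle
hold trivially. -/
structure IteratedMonoidal (n : ℕ) (V : Type u) [Category.{v} V] extends TensorData n V where
  assoc (i : Fin n) (A B C : V) :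
    toTensorData.ob i (toTensorData.ob i A B) C ≅ toTensorData.ob i A (toTensorData.ob i B C)
  leftUnitor (i : Fin n) (A : V) : toTensorData.ob i unit A ≅ A
  rightUnitor (i : Fin n) (A : V) : toTensorData.ob i A unit ≅ A
  assoc_naturality (i : Fin n) {A A' B B' C C' : V} (f : A ⟶ A') (g : B ⟶ B') (h : C ⟶ C') :
    toTensorData.hom i (toTensorData.hom i f g) h ≫ (assoc i A' B' C').hom =
      (assoc i A B C).hom ≫ toTensorData.hom i f (toTensorData.hom i g h)
  leftUnitor_naturality (i : Fin n) {A A' : V} (f : A ⟶ A') :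
    toTensorData.hom i (𝟙 unit) f ≫ (leftUnitor i A').hom = (leftUnitor i A).hom ≫ f
  rightUnitor_naturality (i : Fin n) {A A' : V} (f : A ⟶ A') :
    toTensorData.hom i f (𝟙 unit) ≫ (rightUnitor i A').hom = (rightUnitor i A).hom ≫ f
  pentagon (i : Fin n) (U W X Y : V) :
    toTensorData.hom i (assoc i U W X).hom (𝟙 Y) ≫
        (assoc i U (toTensorData.ob i W X) Y).hom ≫
          toTensorData.hom i (𝟙 U) (assoc i W X Y).hom =
      (assoc i (toTensorData.ob i U W) X Y).hom ≫ (assoc i U W (toTensorData.ob i X Y)).hom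
  triangle (i : Fin n) (A B : V) :
    (assoc i A unit B).hom ≫ toTensorData.hom i (𝟙 A) (leftUnitor i B).hom =
      toTensorData.hom i (rightUnitor i A).hom (𝟙 B)
  /-- The interchangers `η^{ij}_{ABCD} : (A ⊗ⱼ B) ⊗ᵢ (C ⊗ⱼ D) ⟶ (A ⊗ᵢ C) ⊗ⱼ (B ⊗ᵢ D)`. -/
  eta (i j : Fin n) (hij : i < j) (A B C D : V) :
    toTensorData.ob i (toTensorData.ob j A B) (toTensorData.ob j C D) ⟶
      toTensorData.ob j (toTensorData.ob i A C) (toTensorData.ob i B D)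
  eta_naturality (i j : Fin n) (hij : i < j) {A A' B B' C C' D D' : V}
    (a : A ⟶ A') (b : B ⟶ B') (c : C ⟶ C') (d : D ⟶ D') :
    toTensorData.hom i (toTensorData.hom j a b) (toTensorData.hom j c d) ≫
        eta i j hij A' B' C' D' =
      eta i j hij A B C D ≫
        toTensorData.hom j (toTensorData.hom i a c) (toTensorData.hom i b d)
  internal_unit_right (i j : Fin n) (hij : i < j) (A B : V) :
    eta i j hij A B unit unit ≫
        toTensorData.hom j (rightUnitor i A).hom (rightUnitor i B).hom =
      toTensorData.hom i (𝟙 (toTensorData.ob j A B)) (leftUnitor j unit).hom ≫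
        (rightUnitor i (toTensorData.ob j A B)).hom
  internal_unit_left (i j : Fin n) (hij : i < j) (A B : V) :
    eta i j hij unit unit A B ≫
        toTensorData.hom j (leftUnitor i A).hom (leftUnitor i B).hom =
      toTensorData.hom i (leftUnitor j unit).hom (𝟙 (toTensorData.ob j A B)) ≫
        (leftUnitor i (toTensorData.ob j A B)).hom
  external_unit_right (i j : Fin n) (hij : i < j) (A B : V) :
    eta i j hij A unit B unit ≫
        toTensorData.hom j (𝟙 (toTensorData.ob i A B)) (leftUnitor i unit).hom ≫
          (rightUnitor j (toTensorData.ob i A B)).hom =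
      toTensorData.hom i (rightUnitor j A).hom (rightUnitor j B).hom
  external_unit_left (i j : Fin n) (hij : i < j) (A B : V) :
    eta i j hij unit A unit B ≫
        toTensorData.hom j (leftUnitor i unit).hom (𝟙 (toTensorData.ob i A B)) ≫
          (leftUnitor j (toTensorData.ob i A B)).hom =
      toTensorData.hom i (leftUnitor j A).hom (leftUnitor j B).hom
  internal_assoc (i j : Fin n) (hij : i < j) (U U' W W' Y Y' : V) :
    toTensorData.hom i (eta i j hij U U' W W') (𝟙 (toTensorData.ob j Y Y')) ≫
        eta i j hij (toTensorData.ob i U W) (toTensorData.ob i U' W') Y Y' ≫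
          toTensorData.hom j (assoc i U W Y).hom (assoc i U' W' Y').hom =
      (assoc i (toTensorData.ob j U U') (toTensorData.ob j W W') (toTensorData.ob j Y Y')).hom ≫
        toTensorData.hom i (𝟙 (toTensorData.ob j U U')) (eta i j hij W W' Y Y') ≫
          eta i j hij U U' (toTensorData.ob i W Y) (toTensorData.ob i W' Y')
  external_assoc (i j : Fin n) (hij : i < j) (U U' U'' X X' X'' : V) :
    eta i j hij (toTensorData.ob j U U') U'' (toTensorData.ob j X X') X'' ≫
        toTensorData.hom j (eta i j hij U U' X X') (𝟙 (toTensorData.ob i U'' X'')) ≫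
          (assoc j (toTensorData.ob i U X) (toTensorData.ob i U' X')
            (toTensorData.ob i U'' X'')).hom =
      toTensorData.hom i (assoc j U U' U'').hom (assoc j X X' X'').hom ≫
        eta i j hij U (toTensorData.ob j U' U'') X (toTensorData.ob j X' X'') ≫
          toTensorData.hom j (𝟙 (toTensorData.ob i U X)) (eta i j hij U' U'' X' X'')
  /-- The giant hexagon for three different products. -/
  hexagon (i j k : Fin n) (hij : i < j) (hjk : j < k) (A A' B B' C C' D D' : V) :
    toTensorData.hom i (eta j k hjk A A' B B') (eta j k hjk C C' D D') ≫
        eta i k (hij.trans hjk) (toTensorData.ob j A B) (toTensorData.ob j A' B')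
          (toTensorData.ob j C D) (toTensorData.ob j C' D') ≫
          toTensorData.hom k (eta i j hij A B C D) (eta i j hij A' B' C' D') =
      eta i j hij (toTensorData.ob k A A') (toTensorData.ob k B B')
          (toTensorData.ob k C C') (toTensorData.ob k D D') ≫
        toTensorData.hom j (eta i k (hij.trans hjk) A A' C C')
            (eta i k (hij.trans hjk) B B' D D') ≫
          eta j k hjk (toTensorData.ob i A C) (toTensorData.ob i A' C')
            (toTensorData.ob i B D) (toTensorData.ob i B' D')

namespace IteratedMonoidal

variable {n : ℕ} {V : Type u} [Category.{v} V] (M : IteratedMonoidal n V)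

/-- All the functors `- ⊗ᵢ A` and `A ⊗ᵢ -` preserve (set-indexed) coproducts, among them the empty
one, the initial object. -/
structure PreservesCoproducts : Prop where
  left (i : Fin n) (A : V) (J : Type) :
    PreservesColimitsOfShape (Discrete J) ((M.tensor i).flip.obj A)
  right (i : Fin n) (A : V) (J : Type) :
    PreservesColimitsOfShape (Discrete J) ((M.tensor i).obj A)

/-! ### Iterated products and the interchangers between them -/

/-- `f b₁ ⊗_q (f b₂ ⊗_q (⋯ ⊗_q (f b_k ⊗_q I)))` for a list `[b₁, …, b_k]`. -/
def iter (q : Fin n) {β : Type} (f : β → V) : List β → V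
  | [] => M.unit
  | b :: l => M.ob q (f b) (iter q f l)

/-- The product of a family of morphisms over a list. -/
def iterMap (q : Fin n) {β : Type} {f g : β → V} (φ : ∀ b, f b ⟶ g b) :
    ∀ l : List β, M.iter q f l ⟶ M.iter q g l
  | [] => 𝟙 _
  | b :: l => M.hom q (φ b) (iterMap q φ l)

/-- The product of a family of morphisms over a list, the target being reindexed along `r`. -/
def iterMapTo (q : Fin n) {β β' : Type} {f : β → V} {g : β' → V} (r : β → β')
    (φ : ∀ b, f b ⟶ g (r b)) : ∀ l : List β, M.iter q f l ⟶ M.iter q g (l.map r)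
  | [] => 𝟙 _
  | b :: l => M.hom q (φ b) (iterMapTo q r φ l)

/-- The canonical rebracketing of a product over a concatenated list (an identity in the strict
case). -/
def iterAppend (q : Fin n) {β : Type} (f : β → V) :
    ∀ l l' : List β, M.iter q f (l ++ l') ⟶ M.ob q (M.iter q f l) (M.iter q f l')
  | [], l' => (M.leftUnitor q (M.iter q f l')).inv
  | b :: l, l' => M.hom q (𝟙 (f b)) (iterAppend q f l l') ≫
      (M.assoc q (f b) (M.iter q f l) (M.iter q f l')).inv

/-- The map `(⨂_q C(j_s)) ⊗_p (⨂_q D(i_t)) ⟶ ⨂_q (C(j_s) ⊗_p ⨂_q D(i_{u + g_{s-1}}))` made of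
instances of `η^{pq}`. The `s`-th member of the list `L` is the `s`-th block of the sequence of the
`i_t`, its length is `j_s`, and the sequence of the `i_t` is the concatenation of the blocks. -/
def iterEta (p q : Fin n) (hpq : p < q) (C D : ℕ → V) :
    ∀ L : List (List ℕ),
      M.ob p (M.iter q C (L.map List.length)) (M.iter q D L.flatten) ⟶
        M.iter q (fun l => M.ob p (C l.length) (M.iter q D l)) L
  | [] => (M.leftUnitor p M.unit).hom
  | l :: L =>
      M.hom p (𝟙 (M.ob q (C l.length) (M.iter q C (L.map List.length))))
          (M.iterAppend q D l L.flatten) ≫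
        M.eta p q hpq (C l.length) (M.iter q C (L.map List.length))
          (M.iter q D l) (M.iter q D L.flatten) ≫
        M.hom q (𝟙 (M.ob p (C l.length) (M.iter q D l))) (iterEta p q hpq C D L)

/-- `⨂_q^k J : I = ⨂_q^k I ⟶ ⨂_q^k C(1)`. -/
def iterUnit (q : Fin n) {C : ℕ → V} (J : M.unit ⟶ C 1) :
    ∀ k : ℕ, M.unit ⟶ M.iter q C (List.replicate k 1)
  | 0 => 𝟙 _
  | k + 1 => (M.leftUnitor q M.unit).inv ≫ M.hom q J (iterUnit q J k)

/-- `η^{pq}_{AIIB} : A ⊗_p B ⟶ A ⊗_q B` for `p < q`, and the identity for `p = q`. -/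
def change (p q : Fin n) (hpq : p ≤ q) (A B : V) : M.ob p A B ⟶ M.ob q A B :=
  if h : p < q then
    M.hom p (M.rightUnitor q A).inv (M.leftUnitor q B).inv ≫
      M.eta p q h A M.unit M.unit B ≫
      M.hom q (M.rightUnitor p A).hom (M.leftUnitor p B).hom
  else eqToHom (by rw [le_antisymm hpq (not_lt.mp h)])

/-- The map `⨂_s f(b) ⟶ ⨂_r f(b)` made of the maps `η^{sr}_{AIIB}`. -/
def iterChange (s r : Fin n) (hsr : s ≤ r) {β : Type} (f : β → V) :
    ∀ l : List β, M.iter s f l ⟶ M.iter r f l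
  | [] => 𝟙 _
  | b :: l => M.hom s (𝟙 (f b)) (iterChange s r hsr f l) ≫ M.change s r hsr (f b) (M.iter r f l)

/-- The map `A ⊗_p (⨂_s C(j_t)) ⟶ A ⊗_q (⨂_r C(j_t))`: first `1 ⊗_p η^{sr}`, then `η^{pq}`. -/
def domainChange (p s q r : Fin n) (hpq : p ≤ q) (hsr : s ≤ r) (A : V) (C : ℕ → V) (l : List ℕ) :
    M.ob p A (M.iter s C l) ⟶ M.ob q A (M.iter r C l) :=
  M.hom p (𝟙 A) (M.iterChange s r hsr C l) ≫ M.change p q hpq A (M.iter r C l)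

/-! ### The expanded definition of an `m`-fold operad -/

/-- The data of an `m`-fold operad on the collection `C`: a unit and, for all `p < q` among the first
`m` products, compositions `γ^{pq} : C(k) ⊗_p (C(j₁) ⊗_q ⋯ ⊗_q C(j_k)) ⟶ C(j)` with `k ≥ 1` and
`j = j₁ + ⋯ + j_k`; here `l = [j₁, …, j_k]`. -/
structure OperadData (m : ℕ) (C : ℕ → V) where
  unit : M.unit ⟶ C 1
  comp (p q : Fin n) (hpq : p < q) (hq : q.val < m) {k j : ℕ} (l : List ℕ) (hpos : 1 ≤ k)
    (hk : l.length = k) (hj : l.sum = j) : M.ob p (C k) (M.iter q C l) ⟶ C j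

namespace OperadData

variable {M} {m : ℕ} {C : ℕ → V}

/-- The composition `γ^{pq}`, extended to `k = 0` by the canonical map `C(0) ⊗_p I ⟶ C(0)`
(the identity of `C(0)` in the strict case). It occurs in the associativity axiom when some `j_s` or
their sum is zero. -/
def gam (O : M.OperadData m C) (p q : Fin n) (hpq : p < q) (hq : q.val < m) {k j : ℕ} :
    ∀ (l : List ℕ), l.length = k → l.sum = j → (M.ob p (C k) (M.iter q C l) ⟶ C j)
  | [], hk, hj => (M.rightUnitor p (C k)).hom ≫ eqToHom (congrArg C (hk.symm.trans hj))
  | a :: l, hk, hj =>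
      O.comp p q hpq hq (a :: l) (hk ▸ Nat.le_add_left 1 l.length) hk hj

end OperadData

/-- An `m`-fold operad structure on the collection `C`, in expanded form. -/
structure ExpandedOperad (m : ℕ) (C : ℕ → V) extends M.OperadData m C where
  /-- In the notation of `iterEta`: `L` has `k` members, `j` is the sum of their lengths `j_s`,
  `i` is the sum of all their entries, and `h_s` is the sum of the entries of the `s`-th member. -/
  associativity (p q : Fin n) (hpq : p < q) (hq : q.val < m) {k j i : ℕ} (L : List (List ℕ))
    (_hpos : 1 ≤ k) (hk : L.length = k) (hj : L.flatten.length = j) (hi : L.flatten.sum = i) :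
    M.hom p (toOperadData.gam p q hpq hq (L.map List.length) ((List.length_map _).trans hk)
        (List.length_flatten.symm.trans hj)) (𝟙 (M.iter q C L.flatten)) ≫
      toOperadData.gam p q hpq hq L.flatten hj hi =
    (M.assoc p (C k) (M.iter q C (L.map List.length)) (M.iter q C L.flatten)).hom ≫
      M.hom p (𝟙 (C k)) (M.iterEta p q hpq C C L) ≫
      M.hom p (𝟙 (C k)) (M.iterMapTo q List.sum
        (fun l => toOperadData.gam p q hpq hq l rfl rfl) L) ≫
      toOperadData.gam p q hpq hq (L.map List.sum) ((List.length_map _).trans hk)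
        (List.sum_flatten.symm.trans hi)
  unit_right (p q : Fin n) (hpq : p < q) (hq : q.val < m) (k : ℕ) :
    (M.rightUnitor p (C k)).inv ≫ M.hom p (𝟙 (C k)) (M.iterUnit q toOperadData.unit k) ≫
      toOperadData.gam p q hpq hq (List.replicate k 1) List.length_replicate (by simp) = 𝟙 (C k)
  unit_left (p q : Fin n) (hpq : p < q) (hq : q.val < m) (k : ℕ) :
    (M.leftUnitor p (C k)).inv ≫ M.hom p toOperadData.unit (M.rightUnitor q (C k)).inv ≫
      toOperadData.gam p q hpq hq [k] rfl (by simp) = 𝟙 (C k)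

namespace ExpandedOperad

variable {M} {m : ℕ} {C D : ℕ → V}

/-- The compositions are compatible with the interchangers: for `p < s ≤ q + 1 ≤ m`,
`γ^{ps} = γ^{q,q+1} ∘ (η^{pq} ∘ (1 ⊗ η^{s,q+1}))`. -/
def Compatible (O : M.ExpandedOperad m C) : Prop :=
  ∀ (p s q r : Fin n) (hps : p < s) (hsr : s ≤ r) (hqr : q.val + 1 = r.val) (hr : r.val < m)
    (k j : ℕ) (l : List ℕ) (hpos : 1 ≤ k) (hk : l.length = k) (hj : l.sum = j),
    O.comp p s hps (lt_of_le_of_lt hsr hr) l hpos hk hj =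
      M.domainChange p s q r (by omega) hsr (C k) C l ≫
        O.comp q r (by omega) hr l hpos hk hj

/-- Morphisms of collections that commute with the units and with all the compositions. -/
structure IsHom (O : M.ExpandedOperad m C) (O' : M.ExpandedOperad m D) (f : ∀ j, C j ⟶ D j) :
    Prop where
  unit : O.unit ≫ f 1 = O'.unit
  comp (p q : Fin n) (hpq : p < q) (hq : q.val < m) (k j : ℕ) (l : List ℕ) (hpos : 1 ≤ k)
    (hk : l.length = k) (hj : l.sum = j) :
    O.comp p q hpq hq l hpos hk hj ≫ f j =
      M.hom p (f k) (M.iterMap q f l) ≫ O'.comp p q hpq hq l hpos hk hj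

end ExpandedOperad

/-! ### Collections and the product `⊗^{pq}` of collections -/

/-- For a functor `- ⊗_p Y` that preserves coproducts, a map out of `(∐ X) ⊗_p Y` is a family of maps
out of the `X b ⊗_p Y`. -/
noncomputable def descLeft [HasCoproducts.{0} V] (hM : M.PreservesCoproducts) (p : Fin n)
    {J : Type} (X : J → V) (Y : V) {Z : V} (φ : ∀ b, M.ob p (X b) Y ⟶ Z) :
    M.ob p (∐ X) Y ⟶ Z :=
  haveI := hM.left p Y J
  Cofan.IsColimit.desc
    (isColimitOfHasCoproductOfPreservesColimit ((M.tensor p).flip.obj Y) X) φ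

/-- `(B ⊗^{pq} C)(j) = ∐ B(k) ⊗_p (C(j₁) ⊗_q ⋯ ⊗_q C(j_k))` over all `k ≥ 0` and all
`j₁ + ⋯ + j_k = j`. -/
noncomputable def colTensor [HasCoproducts.{0} V] (p q : Fin n) (B C : ℕ → V) : ℕ → V := fun j =>
  ∐ fun l : {l : List ℕ // l.sum = j} => M.ob p (B l.1.length) (M.iter q C l.1)

/-- The inclusion of the summand of `(B ⊗^{pq} C)(j)` that belongs to `l = [j₁, …, j_k]`. -/
noncomputable def colι [HasCoproducts.{0} V] (p q : Fin n) (B C : ℕ → V) {k j : ℕ} (l : List ℕ)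
    (hk : l.length = k) (hj : l.sum = j) :
    M.ob p (B k) (M.iter q C l) ⟶ M.colTensor p q B C j :=
  eqToHom (by rw [hk]) ≫
    Sigma.ι (fun l : {l : List ℕ // l.sum = j} => M.ob p (B l.1.length) (M.iter q C l.1)) ⟨l, hj⟩

/-- The product `⊗^{pq}` of morphisms of collections. -/
noncomputable def colTensorHom [HasCoproducts.{0} V] (p q : Fin n) {B B' C C' : ℕ → V}
    (f : ∀ j, B j ⟶ B' j) (g : ∀ j, C j ⟶ C' j) (j : ℕ) :
    M.colTensor p q B C j ⟶ M.colTensor p q B' C' j :=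
  Limits.Sigma.map fun l => M.hom p (f l.1.length) (M.iterMap q g l.1)

/-- The lax associator `(B ⊗^{pq} C) ⊗^{pq} D ⟶ B ⊗^{pq} (C ⊗^{pq} D)` on the term that belongs to the
list of blocks `L`: reassociate, interchange by `η^{pq}`, and include. -/
noncomputable def colAssocTerm [HasCoproducts.{0} V] (p q : Fin n) (hpq : p < q) (B C D : ℕ → V)
    {i : ℕ} (L : List (List ℕ)) (hi : L.flatten.sum = i) :
    M.ob p (M.ob p (B (L.map List.length).length) (M.iter q C (L.map List.length)))
        (M.iter q D L.flatten) ⟶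
      M.colTensor p q B (M.colTensor p q C D) i :=
  (M.assoc p _ _ _).hom ≫
    M.hom p (𝟙 _) (M.iterEta p q hpq C D L) ≫
    M.hom p (𝟙 _) (M.iterMapTo q (g := M.colTensor p q C D) List.sum
      (fun l => M.colι p q C D l rfl rfl) L) ≫
    M.colι p q B (M.colTensor p q C D) (L.map List.sum) (by simp) (List.sum_flatten.symm.trans hi)

/-- The lax associator `(B ⊗^{pq} C) ⊗^{pq} D ⟶ B ⊗^{pq} (C ⊗^{pq} D)`. The term of the source that
belongs to `l = [i₁, …, i_j]` and `l' = [j₁, …, j_k]` is the one treated above, for the decomposition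
of `l` into blocks of the lengths `j₁, …, j_k`. -/
noncomputable def colAssoc [HasCoproducts.{0} V] (hM : M.PreservesCoproducts) (p q : Fin n)
    (hpq : p < q) (B C D : ℕ → V) (i : ℕ) :
    M.colTensor p q (M.colTensor p q B C) D i ⟶ M.colTensor p q B (M.colTensor p q C D) i :=
  Sigma.desc fun l => M.descLeft hM p _ _ fun l' =>
    have hl : (l'.1.splitLengths l.1).map List.length = l'.1 :=
      List.map_splitLengths_length _ _ (le_of_eq l'.2)
    have hf : (l'.1.splitLengths l.1).flatten = l.1 :=
      List.flatten_splitLengths _ _ (le_of_eq l'.2.symm)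
    eqToHom (by rw [hl, hf]) ≫
      M.colAssocTerm p q hpq B C D (l'.1.splitLengths l.1) (by rw [hf]; exact l.2)

theorem hasInitial [HasCoproducts.{0} V] : HasInitial V :=
  haveI : HasColimitsOfShape (Discrete PEmpty.{1}) V := inferInstance
  inferInstance

/-- The unit collection `(∅, I, ∅, ∅, …)`, where `∅` is the initial object. -/
noncomputable def colUnit [HasCoproducts.{0} V] : ℕ → V
  | 0 => haveI : HasInitial V := hasInitial; ⊥_ V
  | 1 => M.unit
  | _ + 2 => haveI : HasInitial V := hasInitial; ⊥_ V

/-- The canonical map `C ⟶ 𝓘 ⊗^{pq} C`, whose value in degree `j` is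
`C(j) = I ⊗_p C(j) ⟶ ∐ 𝓘(k) ⊗_p (C(j₁) ⊗_q ⋯ ⊗_q C(j_k))`. -/
noncomputable def colLeftUnitorInv [HasCoproducts.{0} V] (p q : Fin n) (C : ℕ → V) (j : ℕ) :
    C j ⟶ M.colTensor p q M.colUnit C j :=
  (M.leftUnitor p (C j)).inv ≫ M.hom p (𝟙 M.unit) (M.rightUnitor q (C j)).inv ≫
    M.colι p q M.colUnit C (k := 1) [j] rfl (by simp)

/-- The canonical map `C ⟶ C ⊗^{pq} 𝓘`, whose value in degree `j` is
`C(j) = C(j) ⊗_p (I ⊗_q ⋯ ⊗_q I) ⟶ ∐ C(k) ⊗_p (𝓘(j₁) ⊗_q ⋯ ⊗_q 𝓘(j_k))`. -/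
noncomputable def colRightUnitorInv [HasCoproducts.{0} V] (p q : Fin n) (C : ℕ → V) (j : ℕ) :
    C j ⟶ M.colTensor p q C M.colUnit j :=
  (M.rightUnitor p (C j)).inv ≫
    M.hom p (𝟙 (C j)) (M.iterUnit q (C := M.colUnit) (𝟙 M.unit) j) ≫
    M.colι p q C M.colUnit (List.replicate j 1) List.length_replicate (by simp)

/-! The two maps are isomorphisms, since all other summands are initial. -/

theorem isIso_sigmaι {J : Type} (X : J → V) [HasCoproduct X] (a : J)
    (hX : ∀ b, b ≠ a → Nonempty (IsInitial (X b))) : IsIso (Sigma.ι X a) := by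
  classical
  refine ⟨⟨Sigma.desc fun b =>
    if h : b = a then eqToHom (by rw [h]) else (hX b h).some.to _, by simp, ?_⟩⟩
  apply Sigma.hom_ext
  intro b
  by_cases h : b = a
  · subst h
    simp
  · exact (hX b h).some.hom_ext _ _

theorem isInitial_ob_left (hM : M.PreservesCoproducts) (i : Fin n) {A : V} (B : V)
    (hA : Nonempty (IsInitial A)) : Nonempty (IsInitial (M.ob i A B)) :=
  haveI := hM.left i B PEmpty
  ⟨IsInitial.isInitialObj ((M.tensor i).flip.obj B) A hA.some⟩

theorem isInitial_ob_right (hM : M.PreservesCoproducts) (i : Fin n) (A : V) {B : V}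
    (hB : Nonempty (IsInitial B)) : Nonempty (IsInitial (M.ob i A B)) :=
  haveI := hM.right i A PEmpty
  ⟨IsInitial.isInitialObj ((M.tensor i).obj A) B hB.some⟩

theorem isInitial_iter (hM : M.PreservesCoproducts) (q : Fin n) {β : Type} (f : β → V) {b : β}
    (hb : Nonempty (IsInitial (f b))) :
    ∀ l : List β, b ∈ l → Nonempty (IsInitial (M.iter q f l))
  | [], h => by simp at h
  | a :: l, h => by
      rcases List.mem_cons.mp h with h | h
      · subst h
        exact M.isInitial_ob_left hM q _ hb
      · exact M.isInitial_ob_right hM q _ (isInitial_iter hM q f hb l h)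

theorem isInitial_colUnit [HasCoproducts.{0} V] :
    ∀ k : ℕ, k ≠ 1 → Nonempty (IsInitial (M.colUnit k))
  | 0, _ => haveI : HasInitial V := hasInitial; ⟨initialIsInitial⟩
  | 1, h => absurd rfl h
  | _ + 2, _ => haveI : HasInitial V := hasInitial; ⟨initialIsInitial⟩

theorem isIso_hom (i : Fin n) {A A' B B' : V} (f : A ⟶ A') (g : B ⟶ B') [IsIso f] [IsIso g] :
    IsIso (M.hom i f g) := by
  unfold TensorData.hom
  infer_instance

theorem isIso_iterUnit (q : Fin n) {C : ℕ → V} (J : M.unit ⟶ C 1) [IsIso J] :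
    ∀ k : ℕ, IsIso (M.iterUnit q J k)
  | 0 => by
      unfold iterUnit
      exact IsIso.id _
  | k + 1 => by
      have := isIso_iterUnit q J k
      have h := M.isIso_hom q J (M.iterUnit q J k)
      exact IsIso.comp_isIso' (f := (M.leftUnitor q M.unit).inv) inferInstance h

theorem isIso_colι [HasCoproducts.{0} V] (p q : Fin n) (B C : ℕ → V) {k j : ℕ} (l : List ℕ)
    (hk : l.length = k) (hj : l.sum = j)
    (hX : ∀ l' : List ℕ, l'.sum = j → l' ≠ l →
      Nonempty (IsInitial (M.ob p (B l'.length) (M.iter q C l')))) :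
    IsIso (M.colι p q B C l hk hj) := by
  have h := isIso_sigmaι
    (fun l : {l : List ℕ // l.sum = j} => M.ob p (B l.1.length) (M.iter q C l.1)) ⟨l, hj⟩
    (fun b hb => hX b.1 b.2 fun h => hb (Subtype.ext h))
  exact IsIso.comp_isIso' inferInstance h

theorem isIso_colLeftUnitorInv [HasCoproducts.{0} V] (hM : M.PreservesCoproducts) (p q : Fin n)
    (C : ℕ → V) (j : ℕ) : IsIso (M.colLeftUnitorInv p q C j) := by
  have h := M.isIso_colι p q M.colUnit C (k := 1) (j := j) [j] rfl (by simp) (by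
    intro l hl hne
    apply M.isInitial_ob_left hM
    apply M.isInitial_colUnit
    intro h
    obtain ⟨a, rfl⟩ := List.length_eq_one_iff.mp h
    exact hne (by simpa using hl))
  exact IsIso.comp_isIso' inferInstance
    (IsIso.comp_isIso' (M.isIso_hom p (𝟙 M.unit) (M.rightUnitor q (C j)).inv) h)

theorem isIso_colRightUnitorInv [HasCoproducts.{0} V] (hM : M.PreservesCoproducts) (p q : Fin n)
    (C : ℕ → V) (j : ℕ) : IsIso (M.colRightUnitorInv p q C j) := by
  have h := M.isIso_colι p q C M.colUnit (j := j) (List.replicate j 1) List.length_replicate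
    (by simp) (by
    intro l hl hne
    by_cases h : ∀ b ∈ l, b = 1
    · have h1 : l = List.replicate l.length 1 := List.eq_replicate_of_mem h
      have h2 : l.length = j := by
        rw [h1] at hl
        simpa using hl
      exact absurd (h2 ▸ h1) hne
    · push Not at h
      obtain ⟨b, hb, hb1⟩ := h
      exact M.isInitial_ob_right hM p _
        (M.isInitial_iter hM q _ (M.isInitial_colUnit b hb1) l hb))
  have h1 := @isIso_iterUnit _ _ _ M q M.colUnit (𝟙 M.unit) (IsIso.id M.unit) j
  exact IsIso.comp_isIso' inferInstance (IsIso.comp_isIso'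
    (M.isIso_hom p (𝟙 (C j)) (M.iterUnit q (C := M.colUnit) (𝟙 M.unit) j)) h)

/-- The left unitor `𝓘 ⊗^{pq} C ≅ C`. -/
noncomputable def colLeftUnitor [HasCoproducts.{0} V] (hM : M.PreservesCoproducts) (p q : Fin n)
    (C : ℕ → V) (j : ℕ) : M.colTensor p q M.colUnit C j ≅ C j :=
  haveI := M.isIso_colLeftUnitorInv hM p q C j
  (asIso (M.colLeftUnitorInv p q C j)).symm

/-- The right unitor `C ⊗^{pq} 𝓘 ≅ C`. -/
noncomputable def colRightUnitor [HasCoproducts.{0} V] (hM : M.PreservesCoproducts) (p q : Fin n)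
    (C : ℕ → V) (j : ℕ) : M.colTensor p q C M.colUnit j ≅ C j :=
  haveI := M.isIso_colRightUnitorInv hM p q C j
  (asIso (M.colRightUnitorInv p q C j)).symm

/-! ### Operads as monoids of collections -/

/-- The structure of a monoid on the collection `C`, for the lax monoidal product `⊗^{pq}`. -/
structure ColMonoid [HasCoproducts.{0} V] (hM : M.PreservesCoproducts) (p q : Fin n) (hpq : p < q)
    (C : ℕ → V) where
  one (j : ℕ) : M.colUnit j ⟶ C j
  mul (j : ℕ) : M.colTensor p q C C j ⟶ C j
  mul_assoc (j : ℕ) :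
    M.colTensorHom p q mul (fun k => 𝟙 (C k)) j ≫ mul j =
      M.colAssoc hM p q hpq C C C j ≫ M.colTensorHom p q (fun k => 𝟙 (C k)) mul j ≫ mul j
  one_mul (j : ℕ) :
    M.colTensorHom p q one (fun k => 𝟙 (C k)) j ≫ mul j = (M.colLeftUnitor hM p q C j).hom
  mul_one (j : ℕ) :
    M.colTensorHom p q (fun k => 𝟙 (C k)) one j ≫ mul j = (M.colRightUnitor hM p q C j).hom

namespace ColMonoid

variable {M} [HasCoproducts.{0} V] {hM : M.PreservesCoproducts} {p q : Fin n} {hpq : p < q}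
  {C D : ℕ → V}

/-- The component `C(k) ⊗_p (C(j₁) ⊗_q ⋯ ⊗_q C(j_k)) ⟶ C(j)` of the multiplication. -/
noncomputable def comp (N : M.ColMonoid hM p q hpq C) {k j : ℕ} (l : List ℕ) (hk : l.length = k)
    (hj : l.sum = j) : M.ob p (C k) (M.iter q C l) ⟶ C j :=
  M.colι p q C C l hk hj ≫ N.mul j

/-- For `p ≤ q` and `s ≤ r`, the monoid structure `N'` for `⊗^{ps}` is built from the monoid structure
`N` for `⊗^{qr}` and the interchanges: the units are equal, and
`γ^{ps} = γ^{qr} ∘ (η^{pq} ∘ (1 ⊗ η^{sr}))`. -/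
structure BuiltFrom {p s q r : Fin n} {hps : p < s} {hqr : q < r} (hpq : p ≤ q) (hsr : s ≤ r)
    (N' : M.ColMonoid hM p s hps C) (N : M.ColMonoid hM q r hqr C) : Prop where
  one (j : ℕ) : N'.one j = N.one j
  comp (k j : ℕ) (l : List ℕ) (hk : l.length = k) (hj : l.sum = j) :
    N'.comp l hk hj = M.domainChange p s q r hpq hsr (C k) C l ≫ N.comp l hk hj

/-- Homomorphisms of monoids in the category of collections. -/
structure IsHom (N : M.ColMonoid hM p q hpq C) (N' : M.ColMonoid hM p q hpq D)
    (f : ∀ j, C j ⟶ D j) : Prop where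
  one (j : ℕ) : N.one j ≫ f j = N'.one j
  mul (j : ℕ) : N.mul j ≫ f j = M.colTensorHom p q f f j ≫ N'.mul j

end ColMonoid

/-- The product number `m - 1`, for `2 ≤ m ≤ n`. -/
def lower {n : ℕ} (m : ℕ) (hm : 2 ≤ m) (hn : m ≤ n) : Fin n := ⟨m - 2, by omega⟩

/-- The product number `m`, for `2 ≤ m ≤ n`. -/
def upper {n : ℕ} (m : ℕ) (hm : 2 ≤ m) (hn : m ≤ n) : Fin n := ⟨m - 1, by omega⟩

theorem lower_lt_upper {n : ℕ} (m : ℕ) (hm : 2 ≤ m) (hn : m ≤ n) :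
    lower m hm hn < upper m hm hn :=
  Fin.mk_lt_mk.mpr (by omega)

theorem le_lower {n : ℕ} {m : ℕ} {hm : 2 ≤ m} {hn : m ≤ n} {p s : Fin n} (hps : p < s)
    (hs : s ≤ upper m hm hn) : p ≤ lower m hm hn := by
  have h1 := Fin.lt_def.mp hps
  have h2 := Fin.le_def.mp hs
  simp only [upper] at h2
  simp only [lower, Fin.le_def]
  omega

/-- An `m`-fold operad structure on the collection `C` in condensed form: a monoid structure in
`Col_m(V)`, the category of collections with the product `⊗^{m-1,m}`. -/
abbrev CondensedOperad [HasCoproducts.{0} V] (hM : M.PreservesCoproducts) (m : ℕ) (hm : 2 ≤ m)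
    (hn : m ≤ n) (C : ℕ → V) :=
  M.ColMonoid hM (lower m hm hn) (upper m hm hn) (lower_lt_upper m hm hn) C

/-- An expanded operad structure and a monoid structure on `C` agree if they have the same unit
`I ⟶ C(1)` and if the composition `γ^{m-1,m}` is the multiplication. -/
structure Agree [HasCoproducts.{0} V] {hM : M.PreservesCoproducts} {m : ℕ} {hm : 2 ≤ m}
    {hn : m ≤ n} {C : ℕ → V} (O : M.ExpandedOperad m C) (N : M.CondensedOperad hM m hm hn C) :
    Prop where
  unit : O.unit = N.one 1
  comp (k j : ℕ) (l : List ℕ) (hpos : 1 ≤ k) (hk : l.length = k) (hj : l.sum = j) :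
    O.comp (lower m hm hn) (upper m hm hn) (lower_lt_upper m hm hn) (Nat.sub_one_lt_of_lt hm)
      l hpos hk hj = N.comp l hk hj

end IteratedMonoidal

/-!
The idea is that the maps `η^{pq}_{AIIB}` make the identity of `V` a lax monoidal functor from
`(V, ⊗_q)` to `(V, ⊗_p)`, and that they commute with the interchangers in both variables, which is
the giant hexagon with units plugged in at four of its eight places. Hence, for `p ≤ q` and `s ≤ r`,
precomposition with `η^{pq} ∘ (1 ⊗_p η^{sr})` turns an operad for the pair `(⊗_q, ⊗_r)` into one for
the pair `(⊗_p, ⊗_s)`, and a compatible family of operads is determined by its last member.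

For a single pair of products, a map out of `C ⊗^{pq} C` or `(C ⊗^{pq} C) ⊗^{pq} C` is the family of
its restrictions to the summands, because the products preserve coproducts, so that the axioms of a
monoid become those of an operad. Only `k = 0` needs attention: there the unit axiom forces the
composition to be the canonical map `C(0) ⊗_p I ⟶ C(0)`.
-/

namespace TensorData

variable {n : ℕ} {V : Type u} [Category.{v} V] (T : TensorData n V)

@[simp]
theorem hom_id (i : Fin n) (A B : V) : T.hom i (𝟙 A) (𝟙 B) = 𝟙 (T.ob i A B) := by
  simp [hom]

@[simp]
theorem hom_comp_hom (i : Fin n) {A A' A'' B B' B'' : V} (f : A ⟶ A') (f' : A' ⟶ A'')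
    (g : B ⟶ B') (g' : B' ⟶ B'') :
    T.hom i f g ≫ T.hom i f' g' = T.hom i (f ≫ f') (g ≫ g') := by
  simp [hom]

@[simp]
theorem hom_comp_hom_assoc (i : Fin n) {A A' A'' B B' B'' Z : V} (f : A ⟶ A') (f' : A' ⟶ A'')
    (g : B ⟶ B') (g' : B' ⟶ B'') (h : T.ob i A'' B'' ⟶ Z) :
    T.hom i f g ≫ T.hom i f' g' ≫ h = T.hom i (f ≫ f') (g ≫ g') ≫ h := by
  rw [← Category.assoc, hom_comp_hom]

end TensorData

namespace IteratedMonoidal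

variable {n : ℕ} {V : Type u} [Category.{v} V] (M : IteratedMonoidal n V)

attribute [local instance] isIso_hom

/-! ### Coherence for a single product -/

section SingleProduct

variable (i : Fin n)

/-- The product `⊗ᵢ` as a monoidal structure in the sense of Mathlib; it gives access to the
coherence lemmas for a single product. -/
@[reducible]
def toMonoidalCategory : MonoidalCategory V :=
  letI : MonoidalCategoryStruct V :=
    { tensorObj := M.ob i
      whiskerLeft := fun X _ _ f => M.hom i (𝟙 X) f
      whiskerRight := fun f Y => M.hom i f (𝟙 Y)
      tensorHom := fun f g => M.hom i f g
      tensorUnit := M.unit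
      associator := M.assoc i
      leftUnitor := M.leftUnitor i
      rightUnitor := M.rightUnitor i }
  MonoidalCategory.ofTensorHom
    (id_tensorHom_id := M.hom_id i)
    (id_tensorHom := fun _ _ _ _ => rfl)
    (tensorHom_id := fun _ _ => rfl)
    (tensorHom_comp_tensorHom := fun _ _ _ _ => M.hom_comp_hom i _ _ _ _)
    (associator_naturality := M.assoc_naturality i)
    (leftUnitor_naturality := M.leftUnitor_naturality i)
    (rightUnitor_naturality := M.rightUnitor_naturality i)
    (pentagon := M.pentagon i)
    (triangle := M.triangle i)

theorem leftUnitor_unit : (M.leftUnitor i M.unit).hom = (M.rightUnitor i M.unit).hom :=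
  letI := M.toMonoidalCategory i
  MonoidalCategory.unitors_equal (C := V)

theorem assoc_comp_leftUnitor (A B : V) :
    (M.assoc i M.unit A B).hom ≫ (M.leftUnitor i (M.ob i A B)).hom =
      M.hom i (M.leftUnitor i A).hom (𝟙 B) :=
  letI := M.toMonoidalCategory i
  (MonoidalCategory.leftUnitor_whiskerRight (C := V) A B).symm

theorem assoc_comp_rightUnitor (A B : V) :
    (M.assoc i A B M.unit).hom ≫ M.hom i (𝟙 A) (M.rightUnitor i B).hom =
      (M.rightUnitor i (M.ob i A B)).hom :=
  letI := M.toMonoidalCategory i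
  (MonoidalCategory.rightUnitor_tensor_hom (C := V) A B).symm

theorem leftUnitor_inv_naturality {A A' : V} (f : A ⟶ A') :
    (M.leftUnitor i A).inv ≫ M.hom i (𝟙 M.unit) f = f ≫ (M.leftUnitor i A').inv := by
  simp [Iso.inv_comp_eq, ← reassoc_of% M.leftUnitor_naturality i f]

theorem rightUnitor_inv_naturality {A A' : V} (f : A ⟶ A') :
    (M.rightUnitor i A).inv ≫ M.hom i f (𝟙 M.unit) = f ≫ (M.rightUnitor i A').inv := by
  simp [Iso.inv_comp_eq, ← reassoc_of% M.rightUnitor_naturality i f]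

theorem assoc_inv_naturality {A A' B B' C C' : V} (f : A ⟶ A') (g : B ⟶ B') (h : C ⟶ C') :
    M.hom i f (M.hom i g h) ≫ (M.assoc i A' B' C').inv =
      (M.assoc i A B C).inv ≫ M.hom i (M.hom i f g) h := by
  rw [Iso.comp_inv_eq, Category.assoc, M.assoc_naturality, Iso.inv_hom_id_assoc]

end SingleProduct

/-! ### The comparison `η_{AIIB}` of two products -/

section Change

variable {i j k : Fin n}

@[simp]
theorem change_self (A B : V) : M.change i i le_rfl A B = 𝟙 _ := by
  simp [change]

theorem change_naturality (h : i ≤ j) {A A' B B' : V} (f : A ⟶ A') (g : B ⟶ B') :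
    M.hom i f g ≫ M.change i j h A' B' = M.change i j h A B ≫ M.hom j f g := by
  rcases h.lt_or_eq with h | rfl
  · have inv_naturality : M.hom i f g ≫ M.hom i (M.rightUnitor j A').inv (M.leftUnitor j B').inv =
        M.hom i (M.rightUnitor j A).inv (M.leftUnitor j B).inv ≫
          M.hom i (M.hom j f (𝟙 M.unit)) (M.hom j (𝟙 M.unit) g) := by
      simp only [TensorData.hom_comp_hom, M.rightUnitor_inv_naturality,
        M.leftUnitor_inv_naturality]
    simp only [change, dif_pos h, Category.assoc, reassoc_of% inv_naturality,
      reassoc_of% M.eta_naturality, TensorData.hom_comp_hom, M.rightUnitor_naturality,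
      M.leftUnitor_naturality]
  · simp

theorem eta_comp_unitors (h : i < j) (A B : V) :
    M.eta i j h A M.unit M.unit B ≫ M.hom j (M.rightUnitor i A).hom (M.leftUnitor i B).hom =
      M.hom i (M.rightUnitor j A).hom (M.leftUnitor j B).hom ≫ M.change i j h.le A B := by
  simp [change, dif_pos h]

theorem eta_comp_augmentations (h : i < j) (A B : V) {X Y : V} (x : X ⟶ M.unit)
    (y : Y ⟶ M.unit) :
    M.eta i j h A X Y B ≫ M.hom j (M.hom i (𝟙 A) y ≫ (M.rightUnitor i A).hom)
        (M.hom i x (𝟙 B) ≫ (M.leftUnitor i B).hom) =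
      M.hom i (M.hom j (𝟙 A) x ≫ (M.rightUnitor j A).hom)
        (M.hom j y (𝟙 B) ≫ (M.leftUnitor j B).hom) ≫ M.change i j h.le A B := by
  simp only [← TensorData.hom_comp_hom, Category.assoc, ← M.eta_comp_unitors h,
    ← reassoc_of% M.eta_naturality]

theorem change_unit_left (h : i ≤ j) (X : V) :
    M.change i j h M.unit X ≫ (M.leftUnitor j X).hom = (M.leftUnitor i X).hom := by
  rcases h.lt_or_eq with h | rfl
  · rw [← cancel_epi (M.hom i (M.rightUnitor j M.unit).hom (M.leftUnitor j X).hom),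
      ← reassoc_of% M.eta_comp_unitors h, ← M.leftUnitor_unit, ← M.leftUnitor_unit,
      reassoc_of% M.internal_unit_left, ← M.leftUnitor_naturality i (M.leftUnitor j X).hom]
    simp
  · simp

theorem change_unit_right (h : i ≤ j) (X : V) :
    M.change i j h X M.unit ≫ (M.rightUnitor j X).hom = (M.rightUnitor i X).hom := by
  rcases h.lt_or_eq with h | rfl
  · rw [← cancel_epi (M.hom i (M.rightUnitor j X).hom (M.leftUnitor j M.unit).hom),
      ← reassoc_of% M.eta_comp_unitors h, M.leftUnitor_unit i,
      reassoc_of% M.internal_unit_right, ← M.rightUnitor_naturality i (M.rightUnitor j X).hom]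
    simp
  · simp

theorem leftUnitor_inv_comp_change (h : i ≤ j) (X : V) :
    (M.leftUnitor i X).inv ≫ M.change i j h M.unit X = (M.leftUnitor j X).inv := by
  rw [Iso.inv_comp_eq, Iso.eq_comp_inv, M.change_unit_left]

theorem rightUnitor_inv_comp_change (h : i ≤ j) (X : V) :
    (M.rightUnitor i X).inv ≫ M.change i j h X M.unit = (M.rightUnitor j X).inv := by
  rw [Iso.inv_comp_eq, Iso.eq_comp_inv, M.change_unit_right]

/-- The hexagon at `A, B, I, I, I, I, C, D`. -/
theorem change_comp_eta (hij : i ≤ j) (hjk : j < k) (A B C D : V) :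
    M.change i j hij (M.ob k A B) (M.ob k C D) ≫ M.eta j k hjk A B C D =
      M.eta i k (hij.trans_lt hjk) A B C D ≫
        M.hom k (M.change i j hij A C) (M.change i j hij B D) := by
  rcases hij.lt_or_eq with hij | rfl
  · let a := M.hom j (𝟙 (M.ob k A B)) (M.leftUnitor k M.unit).hom ≫ (M.rightUnitor j _).hom
    let b := M.hom j (M.leftUnitor k M.unit).hom (𝟙 (M.ob k C D)) ≫ (M.leftUnitor j _).hom
    have ha : M.eta j k hjk A B M.unit M.unit ≫
        M.hom k (M.rightUnitor j A).hom (M.rightUnitor j B).hom = a :=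
      M.internal_unit_right j k hjk A B
    have hb : M.eta j k hjk M.unit M.unit C D ≫
        M.hom k (M.leftUnitor j C).hom (M.leftUnitor j D).hom = b :=
      M.internal_unit_left j k hjk C D
    have hexagon := M.hexagon i j k hij hjk A B M.unit M.unit M.unit M.unit C D =≫
      M.hom k (M.hom j (M.rightUnitor i A).hom (M.leftUnitor i C).hom)
        (M.hom j (M.rightUnitor i B).hom (M.leftUnitor i D).hom)
    refine (cancel_epi (M.hom i a b)).mp ?_
    calc M.hom i a b ≫ M.change i j hij.le (M.ob k A B) (M.ob k C D) ≫ M.eta j k hjk A B C D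
      _ = M.eta i j hij _ _ _ _ ≫
          M.hom j (M.eta i k (hij.trans hjk) A B M.unit M.unit ≫
              M.hom k (M.rightUnitor i A).hom (M.rightUnitor i B).hom)
            (M.eta i k (hij.trans hjk) M.unit M.unit C D ≫
              M.hom k (M.leftUnitor i C).hom (M.leftUnitor i D).hom) ≫
          M.eta j k hjk A B C D := by
        rw [M.internal_unit_right, M.internal_unit_left, reassoc_of% M.eta_comp_augmentations]
      _ = M.hom i (M.eta j k hjk A B M.unit M.unit) (M.eta j k hjk M.unit M.unit C D) ≫
          M.eta i k (hij.trans hjk) _ _ _ _ ≫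
          M.hom k (M.hom i (M.rightUnitor j A).hom (M.leftUnitor j C).hom ≫ M.change i j hij.le A C)
            (M.hom i (M.rightUnitor j B).hom (M.leftUnitor j D).hom ≫
              M.change i j hij.le B D) := by
        rw [← TensorData.hom_comp_hom, Category.assoc, M.eta_naturality,
          ← M.eta_comp_unitors hij, ← M.eta_comp_unitors hij, ← TensorData.hom_comp_hom]
        simpa only [Category.assoc] using hexagon.symm
      _ = M.hom i a b ≫ M.eta i k (hij.trans hjk) A B C D ≫
          M.hom k (M.change i j hij.le A C) (M.change i j hij.le B D) := by
        rw [← TensorData.hom_comp_hom, ← reassoc_of% M.eta_naturality,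
          TensorData.hom_comp_hom_assoc, ha, hb]
  · simp

/-- The hexagon at `A, I, I, B, C, I, I, D`. -/
theorem eta_comp_change (hij : i < j) (hjk : j ≤ k) (A B C D : V) :
    M.eta i j hij A B C D ≫ M.change j k hjk (M.ob i A C) (M.ob i B D) =
      M.hom i (M.change j k hjk A B) (M.change j k hjk C D) ≫
        M.eta i k (hij.trans_le hjk) A B C D := by
  rcases hjk.lt_or_eq with hjk | rfl
  · let ρl (X Y : V) := M.hom j (M.rightUnitor k X).hom (M.leftUnitor k Y).hom
    let a := M.hom j (𝟙 (M.ob i A C)) (M.leftUnitor i M.unit).hom ≫ (M.rightUnitor j _).hom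
    let b := M.hom j (M.leftUnitor i M.unit).hom (𝟙 (M.ob i B D)) ≫ (M.leftUnitor j _).hom
    have hexagon := M.hexagon i j k hij hjk A M.unit M.unit B C M.unit M.unit D =≫ M.hom k a b
    refine (cancel_epi (M.hom i (ρl A B) (ρl C D))).mp ?_
    calc M.hom i (ρl A B) (ρl C D) ≫
          M.eta i j hij A B C D ≫ M.change j k hjk.le (M.ob i A C) (M.ob i B D)
      _ = M.eta i j hij _ _ _ _ ≫
          M.hom j (M.eta i k (hij.trans hjk) A M.unit C M.unit)
            (M.eta i k (hij.trans hjk) M.unit B M.unit D) ≫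
          M.eta j k hjk (M.ob i A C) (M.ob i M.unit M.unit) (M.ob i M.unit M.unit) (M.ob i B D) ≫
          M.hom k a b := by
        rw [M.eta_comp_augmentations hjk, TensorData.hom_comp_hom_assoc, M.external_unit_right,
          M.external_unit_left, ← reassoc_of% M.eta_naturality]
      _ = M.hom i (M.eta j k hjk A M.unit M.unit B) (M.eta j k hjk C M.unit M.unit D) ≫
          M.eta i k (hij.trans hjk) _ _ _ _ ≫
          M.hom k (M.hom i (M.rightUnitor j A).hom (M.rightUnitor j C).hom)
            (M.hom i (M.leftUnitor j B).hom (M.leftUnitor j D).hom) := by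
        simpa only [a, b, Category.assoc, TensorData.hom_comp_hom, M.external_unit_right,
          M.external_unit_left] using hexagon.symm
      _ = M.hom i (ρl A B) (ρl C D) ≫
          M.hom i (M.change j k hjk.le A B) (M.change j k hjk.le C D) ≫
          M.eta i k (hij.trans hjk) A B C D := by
        rw [← M.eta_naturality, TensorData.hom_comp_hom_assoc, TensorData.hom_comp_hom_assoc,
          M.eta_comp_unitors hjk, M.eta_comp_unitors hjk]
  · simp

theorem change_trans (hij : i ≤ j) (hjk : j ≤ k) (A B : V) :
    M.change i j hij A B ≫ M.change j k hjk A B = M.change i k (hij.trans hjk) A B := by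
  rcases hjk.lt_or_eq with hjk | rfl
  · refine (cancel_epi (M.hom i (M.rightUnitor k A).hom (M.leftUnitor k B).hom)).mp ?_
    calc M.hom i (M.rightUnitor k A).hom (M.leftUnitor k B).hom ≫
          M.change i j hij A B ≫ M.change j k hjk.le A B
      _ = M.change i j hij _ _ ≫ M.eta j k hjk A M.unit M.unit B ≫
          M.hom k (M.rightUnitor j A).hom (M.leftUnitor j B).hom := by
        rw [reassoc_of% M.change_naturality, M.eta_comp_unitors hjk]
      _ = M.eta i k (hij.trans_lt hjk) A M.unit M.unit B ≫
          M.hom k (M.rightUnitor i A).hom (M.leftUnitor i B).hom := by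
        rw [reassoc_of% M.change_comp_eta hij hjk, TensorData.hom_comp_hom,
          M.change_unit_right, M.change_unit_left]
      _ = M.hom i (M.rightUnitor k A).hom (M.leftUnitor k B).hom ≫
          M.change i k (hij.trans hjk.le) A B := M.eta_comp_unitors _ A B
  · simp

/-- The interchanger `η_{ABIC} : (A ⊗ⱼ B) ⊗ᵢ C ⟶ A ⊗ⱼ (B ⊗ᵢ C)`, through which both sides of the
associativity of `change` factor. -/
def etaUnit (h : i < j) (A B C : V) : M.ob i (M.ob j A B) C ⟶ M.ob j A (M.ob i B C) :=
  M.hom i (𝟙 _) (M.leftUnitor j C).inv ≫ M.eta i j h A B M.unit C ≫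
    M.hom j (M.rightUnitor i A).hom (𝟙 _)

theorem eta_comp_rightUnitor (h : i < j) (A B C : V) :
    M.eta i j h A B M.unit C ≫ M.hom j (M.rightUnitor i A).hom (𝟙 _) =
      M.hom i (𝟙 _) (M.leftUnitor j C).hom ≫ M.etaUnit h A B C := by
  simp [etaUnit]

theorem change_comp_etaUnit (h : i < j) (A B C : V) :
    M.hom i (M.change i j h.le A B) (𝟙 C) ≫ M.etaUnit h A B C =
      (M.assoc i A B C).hom ≫ M.change i j h.le A (M.ob i B C) := by
  let u := M.hom i (M.rightUnitor j A).hom (M.leftUnitor j B).hom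
  refine (cancel_epi (M.hom i u (M.leftUnitor j C).hom)).mp ?_
  calc M.hom i u (M.leftUnitor j C).hom ≫
        M.hom i (M.change i j h.le A B) (𝟙 C) ≫ M.etaUnit h A B C
    _ = M.hom i (M.eta i j h A M.unit M.unit B) (𝟙 _) ≫
        M.hom i (M.hom j (M.rightUnitor i A).hom (M.leftUnitor i B).hom) (𝟙 _) ≫
        M.eta i j h A B M.unit C ≫ M.hom j (M.rightUnitor i A).hom (𝟙 _) := by
      rw [M.eta_comp_rightUnitor]
      simp [u, ← M.eta_comp_unitors h]
    _ = M.hom i (M.eta i j h A M.unit M.unit B) (𝟙 _) ≫ M.eta i j h _ _ M.unit C ≫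
        M.hom j (M.assoc i A M.unit M.unit).hom (M.assoc i M.unit B C).hom ≫
        M.hom j (M.hom i (𝟙 A) (M.leftUnitor i M.unit).hom ≫ (M.rightUnitor i A).hom)
          (M.leftUnitor i (M.ob i B C)).hom := by
      rw [← M.hom_id j, reassoc_of% M.eta_naturality, TensorData.hom_comp_hom,
        TensorData.hom_comp_hom, reassoc_of% M.triangle, M.assoc_comp_leftUnitor, Category.comp_id]
    _ = (M.assoc i _ _ _).hom ≫ M.hom i (𝟙 _) (M.eta i j h M.unit B M.unit C) ≫
        M.eta i j h A M.unit (M.ob i M.unit M.unit) (M.ob i B C) ≫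
        M.hom j (M.hom i (𝟙 A) (M.leftUnitor i M.unit).hom ≫ (M.rightUnitor i A).hom)
          (M.leftUnitor i (M.ob i B C)).hom := by
      simpa only [Category.assoc] using M.internal_assoc i j h A M.unit M.unit B M.unit C =≫ _
    _ = (M.assoc i _ _ _).hom ≫ M.hom i (M.rightUnitor j A).hom
          (M.hom i (M.leftUnitor j B).hom (M.leftUnitor j C).hom) ≫
        M.change i j h.le A (M.ob i B C) := by
      have := M.eta_comp_augmentations h A (M.ob i B C) (𝟙 M.unit) (M.leftUnitor i M.unit).hom
      simp only [TensorData.hom_id, Category.id_comp] at this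
      rw [this, TensorData.hom_comp_hom_assoc, M.external_unit_left, Category.id_comp]
    _ = M.hom i u (M.leftUnitor j C).hom ≫
        (M.assoc i A B C).hom ≫ M.change i j h.le A (M.ob i B C) := by
      rw [reassoc_of% M.assoc_naturality]

theorem etaUnit_comp_change (h : i < j) (A B C : V) :
    M.etaUnit h A B C ≫ M.hom j (𝟙 A) (M.change i j h.le B C) =
      M.change i j h.le (M.ob j A B) C ≫ (M.assoc j A B C).hom := by
  let w := M.hom j (M.leftUnitor j M.unit).hom (𝟙 C) ≫ (M.leftUnitor j C).hom
  refine (cancel_epi (M.hom i (M.rightUnitor j (M.ob j A B)).hom w)).mp ?_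
  calc M.hom i (M.rightUnitor j (M.ob j A B)).hom w ≫
        M.etaUnit h A B C ≫ M.hom j (𝟙 A) (M.change i j h.le B C)
    _ = M.hom i (M.assoc j A B M.unit).hom (M.assoc j M.unit M.unit C).hom ≫
        M.hom i (M.hom j (𝟙 A) (M.rightUnitor j B).hom) (M.hom j (𝟙 _) (M.leftUnitor j C).hom) ≫
        M.eta i j h A B M.unit C ≫ M.hom j (M.rightUnitor i A).hom (𝟙 _) ≫
        M.hom j (𝟙 A) (M.change i j h.le B C) := by
      rw [TensorData.hom_comp_hom_assoc, M.assoc_comp_rightUnitor, M.triangle,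
        reassoc_of% M.eta_comp_rightUnitor, TensorData.hom_comp_hom_assoc, Category.comp_id,
        ← M.leftUnitor_unit]
    _ = M.hom i (M.assoc j A B M.unit).hom (M.assoc j M.unit M.unit C).hom ≫
        M.eta i j h A (M.ob j B M.unit) M.unit (M.ob j M.unit C) ≫
        M.hom j (𝟙 _) (M.eta i j h B M.unit M.unit C) ≫
        M.hom j (M.rightUnitor i A).hom
          (M.hom j (M.rightUnitor i B).hom (M.leftUnitor i C).hom) := by
      rw [reassoc_of% M.eta_naturality]
      simp only [TensorData.hom_comp_hom, TensorData.hom_id, Category.id_comp, Category.comp_id,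
        M.eta_comp_unitors h]
    _ = M.eta i j h (M.ob j A B) M.unit (M.ob j M.unit M.unit) C ≫
        M.hom j (M.eta i j h A B M.unit M.unit) (𝟙 _) ≫ (M.assoc j _ _ _).hom ≫
        M.hom j (M.rightUnitor i A).hom
          (M.hom j (M.rightUnitor i B).hom (M.leftUnitor i C).hom) := by
      simpa only [Category.assoc] using
        (M.external_assoc i j h A B M.unit M.unit M.unit C =≫ _).symm
    _ = M.eta i j h (M.ob j A B) M.unit (M.ob j M.unit M.unit) C ≫
        M.hom j (M.hom i (𝟙 _) (M.leftUnitor j M.unit).hom ≫ (M.rightUnitor i _).hom)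
          (M.leftUnitor i C).hom ≫ (M.assoc j A B C).hom := by
      rw [← M.assoc_naturality, TensorData.hom_comp_hom_assoc, M.internal_unit_right,
        Category.id_comp]
    _ = M.hom i (M.rightUnitor j (M.ob j A B)).hom w ≫
        M.change i j h.le (M.ob j A B) C ≫ (M.assoc j A B C).hom := by
      have := M.eta_comp_augmentations h (M.ob j A B) C (𝟙 M.unit) (M.leftUnitor j M.unit).hom
      simp only [TensorData.hom_id, Category.id_comp] at this
      rw [reassoc_of% this]

theorem change_assoc (h : i ≤ j) (A B C : V) :
    M.hom i (M.change i j h A B) (𝟙 C) ≫ M.change i j h (M.ob j A B) C ≫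
        (M.assoc j A B C).hom =
      (M.assoc i A B C).hom ≫ M.hom i (𝟙 A) (M.change i j h B C) ≫
        M.change i j h A (M.ob j B C) := by
  rcases h.lt_or_eq with h | rfl
  · rw [← M.etaUnit_comp_change h, reassoc_of% M.change_comp_etaUnit, ← M.change_naturality]
  · simp

theorem change_assoc_inv (h : i ≤ j) (A B C : V) :
    M.hom i (𝟙 A) (M.change i j h B C) ≫ M.change i j h A (M.ob j B C) ≫
        (M.assoc j A B C).inv =
      (M.assoc i A B C).inv ≫ M.hom i (M.change i j h A B) (𝟙 C) ≫
        M.change i j h (M.ob j A B) C := by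
  rw [Iso.eq_inv_comp, ← reassoc_of% M.change_assoc]
  simp

end Change

/-! ### Iterated products -/

section Iter

variable {β β' : Type} {s r t : Fin n}

theorem iterMap_id (q : Fin n) (f : β → V) (l : List β) :
    M.iterMap q (fun b => 𝟙 (f b)) l = 𝟙 _ := by
  induction l with
  | nil => rfl
  | cons b l ih => simp [iterMap, iter, ih]

theorem iterMap_comp_iterMapTo (q : Fin n) {f g : β → V} {g' : β' → V} (ρ : β → β')
    (φ : ∀ b, f b ⟶ g b) (ψ : ∀ b, g b ⟶ g' (ρ b)) (l : List β) :
    M.iterMap q φ l ≫ M.iterMapTo q ρ ψ l = M.iterMapTo q ρ (fun b => φ b ≫ ψ b) l := by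
  induction l with
  | nil => exact Category.id_comp _
  | cons b l ih =>
    dsimp only [List.map, iterMap, iterMapTo, iter]
    rw [TensorData.hom_comp_hom, ih]

theorem iterMapTo_comp_iterMap (q : Fin n) {f : β → V} {g g' : β' → V} (ρ : β → β')
    (φ : ∀ b, f b ⟶ g (ρ b)) (ψ : ∀ b, g b ⟶ g' b) (l : List β) :
    M.iterMapTo q ρ φ l ≫ M.iterMap q ψ (l.map ρ) =
      M.iterMapTo q ρ (fun b => φ b ≫ ψ (ρ b)) l := by
  induction l with
  | nil => exact Category.id_comp _
  | cons b l ih =>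
    dsimp only [List.map, iterMap, iterMapTo, iter]
    rw [TensorData.hom_comp_hom, ih]

theorem iterMapTo_comp_iterChange (h : s ≤ r) {f : β → V} {g : β' → V} (ρ : β → β')
    (φ : ∀ b, f b ⟶ g (ρ b)) (l : List β) :
    M.iterMapTo s ρ φ l ≫ M.iterChange s r h g (l.map ρ) =
      M.iterChange s r h f l ≫ M.iterMapTo r ρ φ l := by
  induction l with
  | nil => rfl
  | cons b l ih =>
    dsimp only [List.map, iterMapTo, iterChange, iter]
    rw [Category.assoc, ← M.change_naturality]
    simp [ih]

theorem iterMap_comp_iterChange (h : s ≤ r) {f g : β → V} (φ : ∀ b, f b ⟶ g b) (l : List β) :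
    M.iterMap s φ l ≫ M.iterChange s r h g l = M.iterChange s r h f l ≫ M.iterMap r φ l := by
  induction l with
  | nil => rfl
  | cons b l ih =>
    dsimp only [iterMap, iterChange, iter]
    rw [Category.assoc, ← M.change_naturality]
    simp [ih]

theorem iterChange_self (s : Fin n) (f : β → V) (l : List β) :
    M.iterChange s s le_rfl f l = 𝟙 _ := by
  induction l with
  | nil => rfl
  | cons b l ih => simp [iterChange, iter, ih]

theorem iterChange_trans (h : s ≤ r) (h' : r ≤ t) (f : β → V) (l : List β) :
    M.iterChange s r h f l ≫ M.iterChange r t h' f l = M.iterChange s t (h.trans h') f l := by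
  induction l with
  | nil => exact Category.id_comp _
  | cons b l ih =>
    dsimp only [iterChange, iter]
    rw [Category.assoc, ← reassoc_of% M.change_naturality, M.change_trans]
    simp [ih]

theorem iterUnit_comp_iterMap (q : Fin n) {C D : ℕ → V} (J : M.unit ⟶ C 1) (f : ∀ j, C j ⟶ D j)
    (k : ℕ) :
    M.iterUnit q J k ≫ M.iterMap q f (List.replicate k 1) = M.iterUnit q (J ≫ f 1) k := by
  induction k with
  | zero => exact Category.id_comp _
  | succ k ih =>
    dsimp only [iterUnit, iterMap, List.replicate, iter]
    rw [Category.assoc, TensorData.hom_comp_hom, ih]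

theorem iterUnit_comp_iterChange (h : s ≤ r) {C : ℕ → V} (J : M.unit ⟶ C 1) (k : ℕ) :
    M.iterUnit s J k ≫ M.iterChange s r h C (List.replicate k 1) = M.iterUnit r J k := by
  induction k with
  | zero => exact Category.id_comp _
  | succ k ih =>
    dsimp only [iterUnit, iterChange, List.replicate, iter]
    rw [Category.assoc, TensorData.hom_comp_hom_assoc, ih, Category.comp_id,
      M.change_naturality, reassoc_of% M.leftUnitor_inv_comp_change]

theorem iterChange_comp_iterAppend (h : s ≤ r) (f : β → V) (l l' : List β) :
    M.iterChange s r h f (l ++ l') ≫ M.iterAppend r f l l' =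
      M.iterAppend s f l l' ≫ M.hom s (M.iterChange s r h f l) (M.iterChange s r h f l') ≫
        M.change s r h (M.iter r f l) (M.iter r f l') := by
  induction l with
  | nil =>
    dsimp only [iterAppend, iterChange, iter, List.append_eq, List.nil_append]
    rw [M.change_naturality, reassoc_of% M.leftUnitor_inv_comp_change, M.leftUnitor_inv_naturality]
  | cons b l ih =>
    dsimp only [iterAppend, iterChange, iter, List.append_eq, List.cons_append]
    let X := M.iter r f l
    let Y := M.iter r f l'
    let cc := M.hom s (M.iterChange s r h f l) (M.iterChange s r h f l')
    calc (M.hom s (𝟙 (f b)) (M.iterChange s r h f (l ++ l')) ≫ M.change s r h (f b) _) ≫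
          M.hom r (𝟙 (f b)) (M.iterAppend r f l l') ≫ (M.assoc r (f b) X Y).inv
      _ = M.hom s (𝟙 (f b)) (M.iterChange s r h f (l ++ l') ≫ M.iterAppend r f l l') ≫
          M.change s r h (f b) (M.ob r X Y) ≫ (M.assoc r (f b) X Y).inv := by
        rw [Category.assoc, ← reassoc_of% M.change_naturality, TensorData.hom_comp_hom_assoc,
          Category.comp_id]
      _ = M.hom s (𝟙 (f b)) (M.iterAppend s f l l' ≫ cc) ≫
          M.hom s (𝟙 (f b)) (M.change s r h X Y) ≫
          M.change s r h (f b) (M.ob r X Y) ≫ (M.assoc r (f b) X Y).inv := by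
        rw [ih, TensorData.hom_comp_hom_assoc, Category.comp_id, Category.assoc]
      _ = M.hom s (𝟙 (f b)) (M.iterAppend s f l l') ≫ M.hom s (𝟙 (f b)) cc ≫
          (M.assoc s (f b) X Y).inv ≫ M.hom s (M.change s r h (f b) X) (𝟙 Y) ≫
          M.change s r h (M.ob r (f b) X) Y := by
        rw [M.change_assoc_inv, TensorData.hom_comp_hom_assoc, Category.comp_id]
      _ = (M.hom s (𝟙 (f b)) (M.iterAppend s f l l') ≫ (M.assoc s (f b) _ _).inv) ≫
          M.hom s (M.hom s (𝟙 (f b)) (M.iterChange s r h f l) ≫ M.change s r h (f b) X)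
            (M.iterChange s r h f l') ≫
          M.change s r h (M.ob r (f b) X) Y := by
        rw [reassoc_of% M.assoc_inv_naturality, TensorData.hom_comp_hom_assoc, Category.comp_id,
          Category.assoc]

theorem iterChange_comp_iterEta {p : Fin n} (hps : p < s) (hsr : s ≤ r) (C D : ℕ → V)
    (L : List (List ℕ)) :
    M.hom p (M.iterChange s r hsr C (L.map List.length)) (M.iterChange s r hsr D L.flatten) ≫
        M.iterEta p r (hps.trans_le hsr) C D L =
      M.iterEta p s hps C D L ≫
        M.iterMap s (fun l => M.hom p (𝟙 (C l.length)) (M.iterChange s r hsr D l)) L ≫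
        M.iterChange s r hsr (fun l => M.ob p (C l.length) (M.iter r D l)) L := by
  induction L with
  | nil =>
    dsimp only [List.map, List.flatten, iterEta, iterMap, iterChange, iter]
    simp
  | cons l L ih =>
    dsimp only [List.map, List.flatten, iterEta, iterMap, iterChange, iter]
    let c := M.iterChange s r hsr C
    let d := M.iterChange s r hsr D
    let e := M.iterEta p r (hps.trans_le hsr) C D L
    calc M.hom p (M.hom s (𝟙 (C l.length)) (c (L.map List.length)) ≫ M.change s r hsr _ _)
            (d (l ++ L.flatten)) ≫
          M.hom p (𝟙 _) (M.iterAppend r D l L.flatten) ≫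
          M.eta p r (hps.trans_le hsr) _ _ _ _ ≫ M.hom r (𝟙 _) e
      _ = M.hom p (𝟙 _) (M.iterAppend s D l L.flatten) ≫
          M.hom p (M.hom s (𝟙 (C l.length)) (c (L.map List.length))) (M.hom s (d l) (d L.flatten)) ≫
          M.hom p (M.change s r hsr _ _) (M.change s r hsr _ _) ≫
          M.eta p r (hps.trans_le hsr) _ _ _ _ ≫ M.hom r (𝟙 _) e := by
        simp only [TensorData.hom_comp_hom_assoc, M.iterChange_comp_iterAppend, d,
          Category.comp_id, Category.id_comp]
      _ = M.hom p (𝟙 _) (M.iterAppend s D l L.flatten) ≫ M.eta p s hps _ _ _ _ ≫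
          M.hom s (M.hom p (𝟙 (C l.length)) (d l))
            (M.hom p (c (L.map List.length)) (d L.flatten) ≫ e) ≫
          M.change s r hsr _ _ := by
        rw [← reassoc_of% M.eta_comp_change hps hsr, ← M.change_naturality,
          reassoc_of% M.eta_naturality, TensorData.hom_comp_hom_assoc, Category.comp_id]
      _ = _ := by
        rw [ih]
        simp [d]

theorem change_comp_iterEta {p q r : Fin n} (hpq : p ≤ q) (hqr : q < r) (C D : ℕ → V)
    (L : List (List ℕ)) :
    M.change p q hpq (M.iter r C (L.map List.length)) (M.iter r D L.flatten) ≫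
        M.iterEta q r hqr C D L =
      M.iterEta p r (hpq.trans_lt hqr) C D L ≫
        M.iterMap r (fun l => M.change p q hpq (C l.length) (M.iter r D l)) L := by
  induction L with
  | nil =>
    dsimp only [List.map, List.flatten, iterEta, iterMap, iterChange, iter]
    rw [Category.comp_id, M.change_unit_left]
  | cons l L ih =>
    dsimp only [List.map, List.flatten, iterEta, iterMap, iterChange, iter]
    rw [← reassoc_of% M.change_naturality, reassoc_of% M.change_comp_eta hpq hqr]
    simp [ih]

end Iter

section DomainChange

variable {p q r s p' r' : Fin n}

theorem domainChange_self (p q : Fin n) (A : V) (C : ℕ → V) (l : List ℕ) :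
    M.domainChange p q p q le_rfl le_rfl A C l = 𝟙 _ := by
  simp [domainChange, M.iterChange_self]

theorem domainChange_trans (hpq : p ≤ q) (hsr : s ≤ r) (hqp : q ≤ p') (hrr : r ≤ r') (A : V)
    (C : ℕ → V) (l : List ℕ) :
    M.domainChange p s q r hpq hsr A C l ≫ M.domainChange q r p' r' hqp hrr A C l =
      M.domainChange p s p' r' (hpq.trans hqp) (hsr.trans hrr) A C l := by
  rw [domainChange, domainChange, domainChange, Category.assoc, ← reassoc_of% M.change_naturality,
    M.change_trans, TensorData.hom_comp_hom_assoc, M.iterChange_trans, Category.comp_id]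

theorem domainChange_naturality (hpq : p ≤ q) (hsr : s ≤ r) {A B : V} {C D : ℕ → V} (g : A ⟶ B)
    (f : ∀ j, C j ⟶ D j) (l : List ℕ) :
    M.hom p g (M.iterMap s f l) ≫ M.domainChange p s q r hpq hsr B D l =
      M.domainChange p s q r hpq hsr A C l ≫ M.hom q g (M.iterMap r f l) := by
  simp only [domainChange, Category.assoc, ← M.change_naturality, TensorData.hom_comp_hom_assoc,
    M.iterMap_comp_iterChange, Category.comp_id, Category.id_comp]

end DomainChange

/-! ### Operads for one pair of products -/

/-- An operad structure on the collection `C` for the pair `(⊗_p, ⊗_q)`. Unlike in `OperadData`, the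
list `l = [j₁, …, j_k]` may be empty; `PairOperad.comp_nil` shows that this adds no data. -/
structure PairOperad (p q : Fin n) (hpq : p < q) (C : ℕ → V) where
  unit : M.unit ⟶ C 1
  comp {k j : ℕ} (l : List ℕ) (hk : l.length = k) (hj : l.sum = j) :
    M.ob p (C k) (M.iter q C l) ⟶ C j
  associativity (L : List (List ℕ)) :
    M.hom p (comp (L.map List.length) rfl List.length_flatten.symm) (𝟙 (M.iter q C L.flatten)) ≫
        comp L.flatten rfl rfl =
      (M.assoc p _ _ _).hom ≫ M.hom p (𝟙 _) (M.iterEta p q hpq C C L) ≫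
        M.hom p (𝟙 _) (M.iterMapTo q List.sum (fun l => comp l rfl rfl) L) ≫
        comp (L.map List.sum) (by simp) List.sum_flatten.symm
  unit_right (k : ℕ) :
    (M.rightUnitor p (C k)).inv ≫ M.hom p (𝟙 (C k)) (M.iterUnit q unit k) ≫
      comp (List.replicate k 1) List.length_replicate (by simp) = 𝟙 (C k)
  unit_left (k : ℕ) :
    (M.leftUnitor p (C k)).inv ≫ M.hom p unit (M.rightUnitor q (C k)).inv ≫
      comp [k] rfl (by simp) = 𝟙 (C k)

namespace PairOperad

variable {M} {C D : ℕ → V} {p q r s : Fin n}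

/-- The unit axiom in degree `0`, where `⨂^0 J` is the identity of `I`. -/
theorem comp_nil {hpq : p < q} (O : M.PairOperad p q hpq C) {k j : ℕ} (hk : [].length = k)
    (hj : [].sum = j) :
    O.comp [] hk hj =
      (M.rightUnitor p (C k)).hom ≫ eqToHom (congrArg C (hk.symm.trans hj)) := by
  subst hk hj
  have id_comp : 𝟙 _ ≫ O.comp [] rfl rfl = (M.rightUnitor p (C 0)).hom ≫ 𝟙 (C 0) :=
    (congrArg (· ≫ O.comp [] rfl rfl) (M.hom_id p (C 0) M.unit).symm).trans
      ((Iso.inv_comp_eq _).mp (O.unit_right 0))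
  exact (Category.id_comp _).symm.trans id_comp

theorem ext {hpq : p < q} {O O' : M.PairOperad p q hpq C} (unit : O.unit = O'.unit)
    (comp : ∀ (k j : ℕ) (l : List ℕ) (_ : 1 ≤ k) (hk : l.length = k) (hj : l.sum = j),
      O.comp l hk hj = O'.comp l hk hj) : O = O' := by
  have comp_eq : @O.comp = @O'.comp := by
    funext k j l hk hj
    cases l with
    | nil => rw [comp_nil, comp_nil]
    | cons a l => exact comp k j _ (hk ▸ Nat.le_add_left 1 l.length) hk hj
  cases O
  cases O'
  congr

/-- Maps of collections that commute with the units and the compositions. -/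
structure IsHom {hpq : p < q} (O : M.PairOperad p q hpq C) (O' : M.PairOperad p q hpq D)
    (f : ∀ j, C j ⟶ D j) : Prop where
  unit : O.unit ≫ f 1 = O'.unit
  comp {k j : ℕ} (l : List ℕ) (hk : l.length = k) (hj : l.sum = j) :
    O.comp l hk hj ≫ f j = M.hom p (f k) (M.iterMap q f l) ≫ O'.comp l hk hj

/-- The operad for `(⊗_p, ⊗_s)` obtained from one for `(⊗_p, ⊗_r)` by precomposition with
`1 ⊗_p η^{sr}`. -/
def changeRight {hpr : p < r} (O : M.PairOperad p r hpr C) (hps : p < s) (hsr : s ≤ r) :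
    M.PairOperad p s hps C where
  unit := O.unit
  comp l hk hj := M.hom p (𝟙 _) (M.iterChange s r hsr C l) ≫ O.comp l hk hj
  associativity L := by
    have h := M.hom p (M.hom p (𝟙 _) (M.iterChange s r hsr C (L.map List.length)))
      (M.iterChange s r hsr C L.flatten) ≫= O.associativity L
    rw [reassoc_of% M.assoc_naturality, TensorData.hom_comp_hom_assoc,
      TensorData.hom_comp_hom_assoc, M.iterChange_comp_iterEta hps hsr] at h
    simp only [TensorData.hom_comp_hom_assoc, Category.id_comp, Category.comp_id,
      Category.assoc] at h ⊢
    rw [h, ← M.iterMap_comp_iterMapTo, Category.assoc, M.iterMapTo_comp_iterChange]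
  unit_right k := by
    rw [TensorData.hom_comp_hom_assoc, M.iterUnit_comp_iterChange, Category.comp_id]
    exact O.unit_right k
  unit_left k := by
    have unit_comp {u : C k ⟶ M.iter s C [k]} {u' : C k ⟶ M.iter r C [k]}
        (hu : u ≫ M.iterChange s r hsr C [k] = u') (γ : M.ob p (C 1) (M.iter r C [k]) ⟶ C k) :
        M.hom p O.unit u ≫ M.hom p (𝟙 _) (M.iterChange s r hsr C [k]) ≫ γ =
          M.hom p O.unit u' ≫ γ := by
      rw [TensorData.hom_comp_hom_assoc, Category.comp_id, hu]
    refine (congrArg _ (unit_comp ?_ _)).trans (O.unit_left k)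
    simp [iterChange, iter, M.rightUnitor_inv_comp_change]

/-- The operad for `(⊗_p, ⊗_r)` obtained from one for `(⊗_q, ⊗_r)` by precomposition with
`η^{pq}`. -/
def changeLeft {hqr : q < r} (O : M.PairOperad q r hqr C) (hpq : p ≤ q) :
    M.PairOperad p r (hpq.trans_lt hqr) C where
  unit := O.unit
  comp {k _} l hk hj := M.change p q hpq (C k) (M.iter r C l) ≫ O.comp l hk hj
  associativity L := by
    have iterEta_comp : M.change p q hpq _ _ ≫ M.iterEta q r hqr C C L ≫
          M.iterMapTo r List.sum (fun l => O.comp l rfl rfl) L =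
        M.iterEta p r (hpq.trans_lt hqr) C C L ≫
          M.iterMapTo r List.sum (fun l => M.change p q hpq _ _ ≫ O.comp l rfl rfl) L := by
      rw [reassoc_of% M.change_comp_iterEta, M.iterMap_comp_iterMapTo]
    have h := (M.hom p (M.change p q hpq _ _) (𝟙 _) ≫ M.change p q hpq _ _) ≫= O.associativity L
    rw [Category.assoc, Category.assoc, reassoc_of% M.change_assoc,
      ← reassoc_of% M.change_naturality, ← reassoc_of% M.change_naturality,
      ← reassoc_of% M.change_naturality] at h
    simp only [TensorData.hom_comp_hom_assoc, Category.comp_id, iterEta_comp] at h ⊢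
    rw [← h]
  unit_right k := by
    rw [reassoc_of% M.change_naturality, reassoc_of% M.rightUnitor_inv_comp_change]
    exact O.unit_right k
  unit_left k := by
    have unit_comp (u : C k ⟶ M.iter r C [k]) (γ : M.ob q (C 1) (M.iter r C [k]) ⟶ C k) :
        (M.leftUnitor p (C k)).inv ≫ M.hom p O.unit u ≫ M.change p q hpq _ _ ≫ γ =
          (M.leftUnitor q (C k)).inv ≫ M.hom q O.unit u ≫ γ := by
      rw [reassoc_of% M.change_naturality, reassoc_of% M.leftUnitor_inv_comp_change]
    exact (unit_comp _ _).trans (O.unit_left k)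

/-- The operad for `(⊗_p, ⊗_s)` obtained from one for `(⊗_q, ⊗_r)` by precomposition with
`η^{pq} ∘ (1 ⊗_p η^{sr})`. -/
def restrict {hqr : q < r} (O : M.PairOperad q r hqr C) (hps : p < s) (hpq : p ≤ q)
    (hsr : s ≤ r) : M.PairOperad p s hps C :=
  (O.changeLeft hpq).changeRight hps hsr

theorem restrict_comp {hqr : q < r} (O : M.PairOperad q r hqr C) (hps : p < s) (hpq : p ≤ q)
    (hsr : s ≤ r) {k j : ℕ} (l : List ℕ) (hk : l.length = k) (hj : l.sum = j) :
    (O.restrict hps hpq hsr).comp l hk hj =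
      M.domainChange p s q r hpq hsr (C k) C l ≫ O.comp l hk hj :=
  (Category.assoc _ _ _).symm

theorem restrict_self {hpq : p < q} (O : M.PairOperad p q hpq C) :
    O.restrict hpq le_rfl le_rfl = O :=
  ext rfl fun _ _ l _ hk hj => by rw [restrict_comp, M.domainChange_self, Category.id_comp]

theorem IsHom.restrict {hqr : q < r} {O : M.PairOperad q r hqr C} {O' : M.PairOperad q r hqr D}
    {f : ∀ j, C j ⟶ D j} (hf : O.IsHom O' f) (hps : p < s) (hpq : p ≤ q) (hsr : s ≤ r) :
    (O.restrict hps hpq hsr).IsHom (O'.restrict hps hpq hsr) f where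
  unit := hf.unit
  comp l hk hj := by
    rw [restrict_comp, restrict_comp, Category.assoc, hf.comp,
      reassoc_of% M.domainChange_naturality]

end PairOperad

/-! ### Morphisms out of products of collections -/

section Collections

variable [HasCoproducts.{0} V] {p q : Fin n} {B B' C C' D E : ℕ → V}

theorem ι_descLeft (hM : M.PreservesCoproducts) (p : Fin n) {J : Type} (X : J → V) (Y : V) {Z : V}
    (φ : ∀ b, M.ob p (X b) Y ⟶ Z) (b : J) :
    M.hom p (Sigma.ι X b) (𝟙 Y) ≫ M.descLeft hM p X Y φ = φ b := by
  have := hM.left p Y J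
  have fac := Cofan.IsColimit.fac
    (isColimitOfHasCoproductOfPreservesColimit ((M.tensor p).flip.obj Y) X) φ b
  simpa [TensorData.hom, descLeft] using fac

theorem hom_ext_left (hM : M.PreservesCoproducts) (p : Fin n) {J : Type} (X : J → V) (Y : V)
    {Z : V} {f g : M.ob p (∐ X) Y ⟶ Z}
    (h : ∀ b, M.hom p (Sigma.ι X b) (𝟙 Y) ≫ f = M.hom p (Sigma.ι X b) (𝟙 Y) ≫ g) : f = g := by
  have := hM.left p Y J
  refine Cofan.IsColimit.hom_ext
    (isColimitOfHasCoproductOfPreservesColimit ((M.tensor p).flip.obj Y) X) f g fun b => ?_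
  simpa [TensorData.hom] using h b

theorem colι_rfl (p q : Fin n) (B C : ℕ → V) {j : ℕ} (l : List ℕ) (hj : l.sum = j) :
    M.colι p q B C l rfl hj =
      Sigma.ι (fun l : {l : List ℕ // l.sum = j} => M.ob p (B l.1.length) (M.iter q C l.1))
        ⟨l, hj⟩ :=
  Category.id_comp _

theorem colι_comp_desc {j : ℕ} {Z : V}
    (φ : ∀ l : {l : List ℕ // l.sum = j}, M.ob p (B l.1.length) (M.iter q C l.1) ⟶ Z)
    (l : List ℕ) (hj : l.sum = j) :
    M.colι p q B C l rfl hj ≫ Sigma.desc φ = φ ⟨l, hj⟩ := by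
  rw [colι_rfl]
  exact Sigma.ι_desc φ ⟨l, hj⟩

theorem colTensor_hom_ext {j : ℕ} {Z : V} {f g : M.colTensor p q B C j ⟶ Z}
    (h : ∀ (l : List ℕ) (hj : l.sum = j),
      M.colι p q B C l rfl hj ≫ f = M.colι p q B C l rfl hj ≫ g) : f = g :=
  Sigma.hom_ext _ _ fun l => by
    have h' := h l.1 l.2
    rw [colι_rfl] at h'
    exact h'

theorem colι_comp_colTensorHom (f : ∀ j, B j ⟶ B' j) (g : ∀ j, C j ⟶ C' j) {k j : ℕ}
    (l : List ℕ) (hk : l.length = k) (hj : l.sum = j) :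
    M.colι p q B C l hk hj ≫ M.colTensorHom p q f g j =
      M.hom p (f k) (M.iterMap q g l) ≫ M.colι p q B' C' l hk hj := by
  subst hk
  rw [colι_rfl, colι_rfl]
  exact Sigma.ι_map _ _

variable (p q B C D) in
/-- The inclusion of the summand of `((B ⊗^{pq} C) ⊗^{pq} D)(i)` that belongs to the list of blocks
`L`: the concatenation of the blocks gives the degrees for `D`, their lengths those for `C`. -/
noncomputable def colιBlocks {i : ℕ} (L : List (List ℕ)) (hi : L.flatten.sum = i) :
    M.ob p (M.ob p (B (L.map List.length).length) (M.iter q C (L.map List.length)))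
        (M.iter q D L.flatten) ⟶ M.colTensor p q (M.colTensor p q B C) D i :=
  M.hom p (M.colι p q B C (L.map List.length) rfl List.length_flatten.symm) (𝟙 _) ≫
    M.colι p q (M.colTensor p q B C) D L.flatten rfl hi

theorem colTensor_colTensor_hom_ext (hM : M.PreservesCoproducts) {i : ℕ} {Z : V}
    {f g : M.colTensor p q (M.colTensor p q B C) D i ⟶ Z}
    (h : ∀ (L : List (List ℕ)) (hi : L.flatten.sum = i),
      M.colιBlocks p q B C D L hi ≫ f = M.colιBlocks p q B C D L hi ≫ g) : f = g := by
  refine M.colTensor_hom_ext fun l hi => M.hom_ext_left hM p _ _ ?_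
  rintro ⟨l', hl'⟩
  obtain ⟨L, rfl, rfl⟩ : ∃ L : List (List ℕ), L.map List.length = l' ∧ L.flatten = l :=
    ⟨l'.splitLengths l, List.map_splitLengths_length _ _ hl'.le,
      List.flatten_splitLengths _ _ hl'.ge⟩
  have h' := h L hi
  simp only [colιBlocks, Category.assoc] at h'
  rw [M.colι_rfl p q B C] at h'
  exact h'

theorem splitLengths_map_length_flatten {α : Type*} (L : List (List α)) :
    (L.map List.length).splitLengths L.flatten = L := by
  induction L with
  | nil => rfl
  | cons l L ih => simp [ih]

theorem colιBlocks_comp_colAssoc (hM : M.PreservesCoproducts) (hpq : p < q) {i : ℕ}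
    (L : List (List ℕ)) (hi : L.flatten.sum = i) :
    M.colιBlocks p q B C D L hi ≫ M.colAssoc hM p q hpq B C D i =
      M.colAssocTerm p q hpq B C D L hi := by
  have eqToHom_comp (L' : List (List ℕ)) (hL : L' = L) (e) (hi' : L'.flatten.sum = i) :
      eqToHom e ≫ M.colAssocTerm p q hpq B C D L' hi' = M.colAssocTerm p q hpq B C D L hi := by
    subst hL
    simp
  rw [colιBlocks, Category.assoc]
  refine (congrArg (_ ≫ ·) (M.colι_comp_desc _ L.flatten hi)).trans ?_
  rw [M.colι_rfl p q B C]
  exact (M.ι_descLeft hM p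
    (fun l : {l : List ℕ // l.sum = L.flatten.length} => M.ob p (B l.1.length) (M.iter q C l.1))
    _ _ ⟨L.map List.length, List.length_flatten.symm⟩).trans
    (eqToHom_comp _ (splitLengths_map_length_flatten L) _ _)

theorem colιBlocks_comp_colTensorHom (f : ∀ j, M.colTensor p q B C j ⟶ E j) {i : ℕ}
    (L : List (List ℕ)) (hi : L.flatten.sum = i) :
    M.colιBlocks p q B C D L hi ≫ M.colTensorHom p q f (fun j => 𝟙 (D j)) i =
      M.hom p (M.colι p q B C (L.map List.length) rfl List.length_flatten.symm ≫ f _) (𝟙 _) ≫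
        M.colι p q E D L.flatten rfl hi := by
  rw [colιBlocks, Category.assoc, M.colι_comp_colTensorHom, M.iterMap_id,
    TensorData.hom_comp_hom_assoc, Category.comp_id]

theorem colAssocTerm_comp_colTensorHom (hpq : p < q) (g : ∀ j, M.colTensor p q C D j ⟶ E j)
    {i : ℕ} (L : List (List ℕ)) (hi : L.flatten.sum = i) :
    M.colAssocTerm p q hpq B C D L hi ≫ M.colTensorHom p q (fun j => 𝟙 (B j)) g i =
      (M.assoc p _ _ _).hom ≫ M.hom p (𝟙 _) (M.iterEta p q hpq C D L) ≫
        M.hom p (𝟙 _) (M.iterMapTo q List.sum (fun l => M.colι p q C D l rfl rfl ≫ g _) L) ≫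
        M.colι p q B E (L.map List.sum) (by simp) (List.sum_flatten.symm.trans hi) := by
  rw [colAssocTerm]
  simp only [Category.assoc]
  rw [M.colι_comp_colTensorHom, M.hom_comp_hom_assoc p (𝟙 _) (𝟙 _) (M.iterMapTo _ _ _ _),
    Category.comp_id, M.iterMapTo_comp_iterMap]

theorem colLeftUnitorInv_comp_colTensorHom (f : ∀ j, M.colUnit j ⟶ B j) (j : ℕ) :
    M.colLeftUnitorInv p q C j ≫ M.colTensorHom p q f (fun j => 𝟙 (C j)) j =
      (M.leftUnitor p (C j)).inv ≫ M.hom p (f 1) (M.rightUnitor q (C j)).inv ≫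
        M.colι p q B C (k := 1) [j] rfl (by simp) := by
  have colι_comp {X : V} (u : X ⟶ M.iter q C [j]) :
      M.hom p (𝟙 (M.colUnit 1)) u ≫ M.colι p q M.colUnit C [j] rfl (by simp) ≫
          M.colTensorHom p q f (fun j => 𝟙 (C j)) j =
        M.hom p (f 1) u ≫ M.colι p q B C [j] rfl (by simp) := by
    rw [M.colι_comp_colTensorHom, M.iterMap_id, TensorData.hom_comp_hom_assoc, Category.id_comp,
      Category.comp_id]
  rw [colLeftUnitorInv, Category.assoc]
  exact congrArg _ ((Category.assoc _ _ _).trans (colι_comp _))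

theorem colRightUnitorInv_comp_colTensorHom (f : ∀ j, M.colUnit j ⟶ C j) (j : ℕ) :
    M.colRightUnitorInv p q B j ≫ M.colTensorHom p q (fun j => 𝟙 (B j)) f j =
      (M.rightUnitor p (B j)).inv ≫ M.hom p (𝟙 (B j)) (M.iterUnit q (f 1) j) ≫
        M.colι p q B C (List.replicate j 1) List.length_replicate (by simp) := by
  have iterUnit_comp : M.iterUnit q (C := M.colUnit) (𝟙 M.unit) j ≫ M.iterMap q f _ =
      M.iterUnit q (f 1) j :=
    (M.iterUnit_comp_iterMap q _ f j).trans (congrArg (M.iterUnit q · j) (Category.id_comp _))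
  rw [colRightUnitorInv, Category.assoc, Category.assoc, M.colι_comp_colTensorHom,
    TensorData.hom_comp_hom_assoc, Category.comp_id, iterUnit_comp]

/-- The map of collections out of the unit collection `(∅, I, ∅, ∅, …)` given by `J : I ⟶ C(1)`. -/
noncomputable def colUnitDesc (J : M.unit ⟶ C 1) : ∀ j, M.colUnit j ⟶ C j
  | 0 => (M.isInitial_colUnit 0 (by simp)).some.to _
  | 1 => J
  | j + 2 => (M.isInitial_colUnit (j + 2) (by simp)).some.to _

theorem colUnit_hom_ext {f g : ∀ j, M.colUnit j ⟶ C j} (h : f 1 = g 1) : f = g := by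
  funext j
  by_cases hj : j = 1
  · subst hj
    exact h
  · exact (M.isInitial_colUnit j hj).some.hom_ext _ _

/-! ### Monoids of collections and operads for one pair of products -/

variable (hM : M.PreservesCoproducts) (hpq : p < q) (one : ∀ j, M.colUnit j ⟶ C j)
  (mul : ∀ j, M.colTensor p q C C j ⟶ C j)

theorem mul_assoc_iff (i : ℕ) :
    M.colTensorHom p q mul (fun k => 𝟙 (C k)) i ≫ mul i =
        M.colAssoc hM p q hpq C C C i ≫ M.colTensorHom p q (fun k => 𝟙 (C k)) mul i ≫ mul i ↔
      ∀ (L : List (List ℕ)) (hi : L.flatten.sum = i),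
        M.hom p (M.colι p q C C (L.map List.length) rfl List.length_flatten.symm ≫ mul _) (𝟙 _) ≫
            M.colι p q C C L.flatten rfl hi ≫ mul i =
          (M.assoc p _ _ _).hom ≫ M.hom p (𝟙 _) (M.iterEta p q hpq C C L) ≫
            M.hom p (𝟙 _) (M.iterMapTo q List.sum (fun l => M.colι p q C C l rfl rfl ≫ mul _) L) ≫
            M.colι p q C C (L.map List.sum) (by simp) (List.sum_flatten.symm.trans hi) ≫
            mul i := by
  have left (L : List (List ℕ)) (hi : L.flatten.sum = i) :=
    M.colιBlocks_comp_colTensorHom (D := C) mul L hi =≫ mul i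
  have right (L : List (List ℕ)) (hi : L.flatten.sum = i) :=
    M.colAssocTerm_comp_colTensorHom (B := C) hpq mul L hi =≫ mul i
  simp only [Category.assoc] at left right
  constructor
  · intro h L hi
    rw [← left, ← right, ← reassoc_of% M.colιBlocks_comp_colAssoc hM hpq, h]
  · refine fun h => M.colTensor_colTensor_hom_ext hM fun L hi => ?_
    rw [left, reassoc_of% M.colιBlocks_comp_colAssoc, right, h]

theorem one_mul_iff (j : ℕ) :
    M.colTensorHom p q one (fun k => 𝟙 (C k)) j ≫ mul j = (M.colLeftUnitor hM p q C j).hom ↔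
      (M.leftUnitor p (C j)).inv ≫ M.hom p (one 1) (M.rightUnitor q (C j)).inv ≫
        M.colι p q C C (k := 1) [j] rfl (by simp) ≫ mul j = 𝟙 (C j) := by
  have inv_comp : (M.colLeftUnitor hM p q C j).inv ≫
        M.colTensorHom p q one (fun k => 𝟙 (C k)) j ≫ mul j =
      (M.leftUnitor p (C j)).inv ≫ M.hom p (one 1) (M.rightUnitor q (C j)).inv ≫
        M.colι p q C C (k := 1) [j] rfl (by simp) ≫ mul j :=
    ((Category.assoc _ _ _).symm.trans (M.colLeftUnitorInv_comp_colTensorHom one j =≫ mul j)).trans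
      ((Category.assoc _ _ _).trans (congrArg _ (Category.assoc _ _ _)))
  rw [← inv_comp, Iso.inv_comp_eq, Category.comp_id]

theorem mul_one_iff (j : ℕ) :
    M.colTensorHom p q (fun k => 𝟙 (C k)) one j ≫ mul j = (M.colRightUnitor hM p q C j).hom ↔
      (M.rightUnitor p (C j)).inv ≫ M.hom p (𝟙 (C j)) (M.iterUnit q (one 1) j) ≫
        M.colι p q C C (List.replicate j 1) List.length_replicate (by simp) ≫ mul j = 𝟙 (C j) := by
  have inv_comp : (M.colRightUnitor hM p q C j).inv ≫
        M.colTensorHom p q (fun k => 𝟙 (C k)) one j ≫ mul j =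
      (M.rightUnitor p (C j)).inv ≫ M.hom p (𝟙 (C j)) (M.iterUnit q (one 1) j) ≫
        M.colι p q C C (List.replicate j 1) List.length_replicate (by simp) ≫ mul j :=
    ((Category.assoc _ _ _).symm.trans (M.colRightUnitorInv_comp_colTensorHom one j =≫ mul j)).trans
      ((Category.assoc _ _ _).trans (congrArg _ (Category.assoc _ _ _)))
  rw [← inv_comp, Iso.inv_comp_eq, Category.comp_id]

end Collections

namespace PairOperad

variable {M} {C D : ℕ → V} {p q : Fin n} {hpq : p < q}

theorem isHom_of_one_le {O : M.PairOperad p q hpq C} {O' : M.PairOperad p q hpq D}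
    {f : ∀ j, C j ⟶ D j} (unit : O.unit ≫ f 1 = O'.unit)
    (comp : ∀ {k j : ℕ} (l : List ℕ) (_ : 1 ≤ k) (hk : l.length = k) (hj : l.sum = j),
      O.comp l hk hj ≫ f j = M.hom p (f k) (M.iterMap q f l) ≫ O'.comp l hk hj) :
    O.IsHom O' f where
  unit := unit
  comp {k j} l hk hj := by
    cases l with
    | nil =>
      subst hk hj
      have naturality : ((M.rightUnitor p (C 0)).hom ≫ 𝟙 (C 0)) ≫ f 0 =
          M.hom p (f 0) (𝟙 M.unit) ≫ (M.rightUnitor p (D 0)).hom ≫ 𝟙 (D 0) := by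
        rw [Category.comp_id, Category.comp_id, M.rightUnitor_naturality]
      rw [comp_nil, comp_nil]
      exact naturality
    | cons a l => exact comp (a :: l) (hk ▸ Nat.le_add_left 1 l.length) hk hj

variable [HasCoproducts.{0} V]

/-- The map `C ⊗^{pq} C ⟶ C` whose components are the compositions of an operad for the pair
`(⊗_p, ⊗_q)`. -/
noncomputable def colMul (O : M.PairOperad p q hpq C) (j : ℕ) : M.colTensor p q C C j ⟶ C j :=
  Sigma.desc fun l => O.comp l.1 rfl l.2

theorem colι_comp_colMul (O : M.PairOperad p q hpq C) {k j : ℕ} (l : List ℕ)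
    (hk : l.length = k) (hj : l.sum = j) :
    M.colι p q C C l hk hj ≫ O.colMul j = O.comp l hk hj := by
  subst hk
  exact M.colι_comp_desc _ l hj

/-- The monoid of collections whose multiplication has the compositions of an operad for the pair
`(⊗_p, ⊗_q)` as its components. -/
noncomputable def toColMonoid (O : M.PairOperad p q hpq C) (hM : M.PreservesCoproducts) :
    M.ColMonoid hM p q hpq C where
  one := M.colUnitDesc O.unit
  mul := O.colMul
  mul_assoc i := (M.mul_assoc_iff hM hpq _ i).mpr fun L hi => by
    subst hi
    simp only [colι_comp_colMul]
    exact O.associativity L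
  one_mul j := (M.one_mul_iff hM _ _ j).mpr <| by
    have h := O.unit_left j
    rw [← colι_comp_colMul] at h
    exact h
  mul_one j := (M.mul_one_iff hM _ _ j).mpr <| by
    rw [colι_comp_colMul]
    exact O.unit_right j

end PairOperad

namespace ColMonoid

variable {M} [HasCoproducts.{0} V] {hM : M.PreservesCoproducts} {p q : Fin n} {hpq : p < q}
  {C D : ℕ → V}

/-- The operad for the pair `(⊗_p, ⊗_q)` formed by the components of the multiplication of a monoid
of collections. -/
noncomputable def toPairOperad (N : M.ColMonoid hM p q hpq C) : M.PairOperad p q hpq C where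
  unit := N.one 1
  comp := N.comp
  associativity L := (M.mul_assoc_iff hM hpq N.mul _).mp (N.mul_assoc _) L rfl
  unit_right k := (M.mul_one_iff hM N.one N.mul k).mp (N.mul_one k)
  unit_left k := (M.one_mul_iff hM N.one N.mul k).mp (N.one_mul k)

theorem toPairOperad_injective :
    Function.Injective (toPairOperad : M.ColMonoid hM p q hpq C → M.PairOperad p q hpq C) := by
  intro N N' h
  have one : N.one = N'.one := M.colUnit_hom_ext (congrArg PairOperad.unit h)
  have mul : N.mul = N'.mul := funext fun j => M.colTensor_hom_ext fun l hj =>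
    congrArg (fun O : M.PairOperad p q hpq C => O.comp l rfl hj) h
  cases N
  cases N'
  congr

theorem toPairOperad_toColMonoid (O : M.PairOperad p q hpq C) :
    (O.toColMonoid hM).toPairOperad = O :=
  PairOperad.ext rfl fun _ _ l _ hk hj => O.colι_comp_colMul l hk hj

theorem toPairOperad_bijective :
    Function.Bijective (toPairOperad : M.ColMonoid hM p q hpq C → M.PairOperad p q hpq C) :=
  ⟨toPairOperad_injective, fun O => ⟨O.toColMonoid hM, toPairOperad_toColMonoid O⟩⟩

theorem isHom_toPairOperad_iff {N : M.ColMonoid hM p q hpq C} {N' : M.ColMonoid hM p q hpq D}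
    {f : ∀ j, C j ⟶ D j} : N.toPairOperad.IsHom N'.toPairOperad f ↔ N.IsHom N' f := by
  have colι_comp {k j : ℕ} (l : List ℕ) (hk : l.length = k) (hj : l.sum = j) :
      M.hom p (f k) (M.iterMap q f l) ≫ N'.comp l hk hj =
        M.colι p q C C l hk hj ≫ M.colTensorHom p q f f j ≫ N'.mul j := by
    rw [comp, reassoc_of% M.colι_comp_colTensorHom]
  constructor
  · refine fun h => ⟨congrFun (M.colUnit_hom_ext h.unit), fun j => ?_⟩
    refine M.colTensor_hom_ext fun l hj => ?_
    rw [← colι_comp, ← Category.assoc]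
    exact h.comp l rfl hj
  · refine fun h => ⟨h.one 1, fun l hk hj => ?_⟩
    refine Eq.trans ?_ (colι_comp l hk hj).symm
    rw [← h.mul]
    exact Category.assoc _ _ _

theorem builtFrom_iff {p s q r : Fin n} {hps : p < s} {hqr : q < r} {hpq : p ≤ q} {hsr : s ≤ r}
    {N' : M.ColMonoid hM p s hps C} {N : M.ColMonoid hM q r hqr C} :
    N'.BuiltFrom hpq hsr N ↔ N'.toPairOperad = N.toPairOperad.restrict hps hpq hsr := by
  constructor
  · exact fun h => PairOperad.ext (h.one 1) fun k j l _ hk hj =>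
      (h.comp k j l hk hj).trans (N.toPairOperad.restrict_comp hps hpq hsr l hk hj).symm
  · refine fun h => ⟨congrFun (M.colUnit_hom_ext (congrArg PairOperad.unit h)),
      fun k j l hk hj => ?_⟩
    exact (congrArg (fun O : M.PairOperad p s hps C => O.comp l hk hj) h).trans
      (N.toPairOperad.restrict_comp hps hpq hsr l hk hj)

theorem existsUnique_builtFrom {p s q r : Fin n} {hqr : q < r} (N : M.ColMonoid hM q r hqr C)
    (hps : p < s) (hpq : p ≤ q) (hsr : s ≤ r) :
    ∃! N' : M.ColMonoid hM p s hps C, N'.BuiltFrom hpq hsr N := by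
  simpa only [builtFrom_iff] using toPairOperad_bijective.existsUnique _

end ColMonoid

/-! ### Expanded operads -/

namespace OperadData

variable {M} {m : ℕ} {C : ℕ → V}

theorem gam_eq_comp (O : M.OperadData m C) {p q : Fin n} (hpq : p < q) (hq : q.val < m) {k j : ℕ}
    (l : List ℕ) (hpos : 1 ≤ k) (hk : l.length = k) (hj : l.sum = j) :
    O.gam p q hpq hq l hk hj = O.comp p q hpq hq l hpos hk hj := by
  cases l with
  | nil => exact absurd hpos (hk ▸ Nat.not_succ_le_zero 0)
  | cons a l => rfl

end OperadData

theorem le_upper {m : ℕ} {hm : 2 ≤ m} {hn : m ≤ n} {q : Fin n} (hq : q.val < m) :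
    q ≤ upper m hm hn :=
  Fin.le_def.mpr (Nat.le_sub_one_of_lt hq)

theorem upper_lt {m : ℕ} (hm : 2 ≤ m) (hn : m ≤ n) : (upper m hm hn).val < m :=
  Nat.sub_one_lt_of_lt hm

/-- Operads for the pair `(⊗_{m-1}, ⊗_m)`, the last pair that occurs in an `m`-fold operad. -/
abbrev TopPairOperad (m : ℕ) (hm : 2 ≤ m) (hn : m ≤ n) (C : ℕ → V) :=
  M.PairOperad (lower m hm hn) (upper m hm hn) (lower_lt_upper m hm hn) C

namespace ExpandedOperad

variable {M} {m : ℕ} {C D : ℕ → V}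

/-- The operad for the pair `(⊗_p, ⊗_q)` contained in an expanded `m`-fold operad. -/
def toPairOperad (O : M.ExpandedOperad m C) (p q : Fin n) (hpq : p < q) (hq : q.val < m) :
    M.PairOperad p q hpq C where
  unit := O.unit
  comp := O.gam p q hpq hq
  associativity
    | [] => by
      have triangle : M.hom p ((M.rightUnitor p (C 0)).hom ≫ 𝟙 (C 0)) (𝟙 M.unit) ≫
          (M.rightUnitor p (C 0)).hom ≫ 𝟙 (C 0) =
          (M.assoc p (C 0) M.unit M.unit).hom ≫
            M.hom p (𝟙 (C 0)) (M.leftUnitor p M.unit).hom ≫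
            M.hom p (𝟙 (C 0)) (𝟙 M.unit) ≫ (M.rightUnitor p (C 0)).hom ≫ 𝟙 (C 0) := by
        rw [M.hom_id, Category.id_comp, reassoc_of% M.triangle, Category.comp_id]
      exact triangle
    | l :: L => O.associativity p q hpq hq (l :: L) (by simp) (by simp) rfl rfl
  unit_right := O.unit_right p q hpq hq
  unit_left := O.unit_left p q hpq hq

theorem toPairOperad_comp (O : M.ExpandedOperad m C) {p q : Fin n} (hpq : p < q)
    (hq : q.val < m) {k j : ℕ} (l : List ℕ) (hpos : 1 ≤ k) (hk : l.length = k) (hj : l.sum = j) :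
    (O.toPairOperad p q hpq hq).comp l hk hj = O.comp p q hpq hq l hpos hk hj :=
  O.gam_eq_comp hpq hq l hpos hk hj

theorem toPairOperad_eq_iff {O : M.ExpandedOperad m C} {p q : Fin n} {hpq : p < q}
    {hq : q.val < m} {P : M.PairOperad p q hpq C} :
    O.toPairOperad p q hpq hq = P ↔ O.unit = P.unit ∧
      ∀ (k j : ℕ) (l : List ℕ) (hpos : 1 ≤ k) (hk : l.length = k) (hj : l.sum = j),
        O.comp p q hpq hq l hpos hk hj = P.comp l hk hj := by
  constructor
  · rintro rfl
    exact ⟨rfl, fun k j l hpos hk hj => (O.toPairOperad_comp hpq hq l hpos hk hj).symm⟩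
  · exact fun h => PairOperad.ext h.1 fun k j l hpos hk hj =>
      (O.toPairOperad_comp hpq hq l hpos hk hj).trans (h.2 k j l hpos hk hj)

theorem isHom_iff {O : M.ExpandedOperad m C} {O' : M.ExpandedOperad m D} {f : ∀ j, C j ⟶ D j} :
    O.IsHom O' f ↔ O.unit ≫ f 1 = O'.unit ∧ ∀ (p q : Fin n) (hpq : p < q) (hq : q.val < m),
      (O.toPairOperad p q hpq hq).IsHom (O'.toPairOperad p q hpq hq) f := by
  constructor
  · refine fun h => ⟨h.unit, fun p q hpq hq => PairOperad.isHom_of_one_le h.unit ?_⟩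
    intro k j l hpos hk hj
    rw [toPairOperad_comp _ hpq hq l hpos, toPairOperad_comp _ hpq hq l hpos, h.comp]
  · refine fun h => ⟨h.1, fun p q hpq hq k j l hpos hk hj => ?_⟩
    rw [← toPairOperad_comp, ← toPairOperad_comp, (h.2 p q hpq hq).comp]

theorem ext_toPairOperad {O O' : M.ExpandedOperad m C} (unit : O.unit = O'.unit)
    (toPairOperad : ∀ (p q : Fin n) (hpq : p < q) (hq : q.val < m),
      O.toPairOperad p q hpq hq = O'.toPairOperad p q hpq hq) : O = O' := by
  have comp : @O.comp = @O'.comp := by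
    funext p q hpq hq k j l hpos hk hj
    rw [(toPairOperad_eq_iff.mp (toPairOperad p q hpq hq)).2, toPairOperad_comp]
  obtain ⟨⟨_, _⟩, _, _, _⟩ := O
  obtain ⟨⟨_, _⟩, _, _, _⟩ := O'
  congr

section Top

/-- The operad for the pair `(⊗_{m-1}, ⊗_m)` contained in an expanded `m`-fold operad. -/
abbrev topPairOperad (O : M.ExpandedOperad m C) (hm : 2 ≤ m) (hn : m ≤ n) :
    M.TopPairOperad m hm hn C :=
  O.toPairOperad (lower m hm hn) (upper m hm hn) (lower_lt_upper m hm hn) (upper_lt hm hn)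

variable {hm : 2 ≤ m} {hn : m ≤ n}

theorem compatible_iff {O : M.ExpandedOperad m C} :
    O.Compatible ↔ ∀ (p q : Fin n) (hpq : p < q) (hq : q.val < m),
      O.toPairOperad p q hpq hq =
        (O.topPairOperad hm hn).restrict hpq (le_lower hpq (le_upper hq)) (le_upper hq) := by
  constructor
  · refine fun h p q hpq hq => toPairOperad_eq_iff.mpr ⟨rfl, fun k j l hpos hk hj => ?_⟩
    rw [PairOperad.restrict_comp, toPairOperad_comp _ _ _ l hpos hk hj]
    exact h p q _ _ hpq (le_upper hq) (by simp only [lower, upper]; omega) _ k j l hpos hk hj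
  · intro h p s q r hps hsr hqr hr k j l hpos hk hj
    have comp_eq {p q : Fin n} (hpq : p < q) (hq : q.val < m) :=
      (toPairOperad_eq_iff.mp (h p q hpq hq)).2 k j l hpos hk hj
    rw [comp_eq, comp_eq, PairOperad.restrict_comp, PairOperad.restrict_comp,
      reassoc_of% M.domainChange_trans]

/-- The compositions `γ^{pq}` built from an operad for the pair `(⊗_{m-1}, ⊗_m)`. -/
def restrictData (P : M.TopPairOperad m hm hn C) : M.OperadData m C where
  unit := P.unit
  comp _ _ hpq hq _ _ l _ hk hj :=
    (P.restrict hpq (le_lower hpq (le_upper hq)) (le_upper hq)).comp l hk hj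

theorem gam_restrictData (P : M.TopPairOperad m hm hn C) {p q : Fin n} (hpq : p < q)
    (hq : q.val < m) {k j : ℕ} (l : List ℕ) (hk : l.length = k) (hj : l.sum = j) :
    (restrictData P).gam p q hpq hq l hk hj =
      (P.restrict hpq (le_lower hpq (le_upper hq)) (le_upper hq)).comp l hk hj := by
  cases l with
  | nil => exact (PairOperad.comp_nil _ hk hj).symm
  | cons a l => rfl

/-- The expanded `m`-fold operad built from an operad for the pair `(⊗_{m-1}, ⊗_m)`. -/
def ofPairOperad (P : M.TopPairOperad m hm hn C) : M.ExpandedOperad m C where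
  toOperadData := restrictData P
  associativity p q hpq hq _ _ _ L _ hk hj hi := by
    obtain rfl := (List.length_map List.length).trans hk
    subst hj hi
    simp only [gam_restrictData]
    exact (P.restrict hpq _ _).associativity L
  unit_right p q hpq hq k := by
    rw [gam_restrictData]
    exact (P.restrict hpq _ _).unit_right k
  unit_left p q hpq hq k := by
    rw [gam_restrictData]
    exact (P.restrict hpq _ _).unit_left k

theorem toPairOperad_ofPairOperad (P : M.TopPairOperad m hm hn C) (p q : Fin n) (hpq : p < q)
    (hq : q.val < m) :
    (ofPairOperad P).toPairOperad p q hpq hq =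
      P.restrict hpq (le_lower hpq (le_upper hq)) (le_upper hq) :=
  toPairOperad_eq_iff.mpr ⟨rfl, fun _ _ _ _ _ _ => rfl⟩

theorem existsUnique_compatible_topPairOperad_eq (P : M.TopPairOperad m hm hn C) :
    ∃! O : M.ExpandedOperad m C, O.Compatible ∧ O.topPairOperad hm hn = P := by
  have top : (ofPairOperad P).topPairOperad hm hn = P :=
    (toPairOperad_ofPairOperad P _ _ _ _).trans P.restrict_self
  have compatible : (ofPairOperad P).Compatible :=
    (compatible_iff (hm := hm) (hn := hn)).mpr fun p q hpq hq => by
      rw [toPairOperad_ofPairOperad, top]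
  refine ⟨ofPairOperad P, ⟨compatible, top⟩, ?_⟩
  rintro O ⟨hO, rfl⟩
  refine ext_toPairOperad rfl fun p q hpq hq => ?_
  rw [toPairOperad_ofPairOperad]
  exact compatible_iff.mp hO p q hpq hq

theorem isHom_iff_of_compatible {O : M.ExpandedOperad m C} {O' : M.ExpandedOperad m D}
    {f : ∀ j, C j ⟶ D j} (hO : O.Compatible) (hO' : O'.Compatible) :
    O.IsHom O' f ↔ (O.topPairOperad hm hn).IsHom (O'.topPairOperad hm hn) f := by
  rw [isHom_iff]
  refine ⟨fun h => h.2 _ _ _ _, fun h => ⟨h.unit, fun p q hpq hq => ?_⟩⟩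
  rw [compatible_iff.mp hO, compatible_iff.mp hO']
  exact h.restrict _ _ _

end Top

end ExpandedOperad

/-! ### Agreement of the two definitions -/

section Agree

variable {M} [HasCoproducts.{0} V] {hM : M.PreservesCoproducts} {m : ℕ} {hm : 2 ≤ m} {hn : m ≤ n}
  {C D : ℕ → V}

theorem agree_iff {O : M.ExpandedOperad m C} {N : M.CondensedOperad hM m hm hn C} :
    M.Agree O N ↔ O.topPairOperad hm hn = N.toPairOperad :=
  ⟨fun h => ExpandedOperad.toPairOperad_eq_iff.mpr ⟨h.unit, h.comp⟩,
    fun h => ⟨congrArg PairOperad.unit h, (ExpandedOperad.toPairOperad_eq_iff.mp h).2⟩⟩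

theorem existsUnique_agree (O : M.ExpandedOperad m C) :
    ∃! N : M.CondensedOperad hM m hm hn C, M.Agree O N := by
  simpa only [agree_iff, eq_comm] using
    ColMonoid.toPairOperad_bijective.existsUnique (O.toPairOperad _ _ _ _)

theorem existsUnique_compatible_agree (N : M.CondensedOperad hM m hm hn C) :
    ∃! O : M.ExpandedOperad m C, O.Compatible ∧ M.Agree O N := by
  simpa only [agree_iff] using
    ExpandedOperad.existsUnique_compatible_topPairOperad_eq N.toPairOperad

theorem Agree.isHom_iff {O : M.ExpandedOperad m C} {O' : M.ExpandedOperad m D}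
    {N : M.CondensedOperad hM m hm hn C} {N' : M.CondensedOperad hM m hm hn D}
    {f : ∀ j, C j ⟶ D j} (h : M.Agree O N) (h' : M.Agree O' N') (hO : O.Compatible)
    (hO' : O'.Compatible) : O.IsHom O' f ↔ N.IsHom N' f := by
  rw [ExpandedOperad.isHom_iff_of_compatible hO hO', agree_iff.mp h, agree_iff.mp h',
    ColMonoid.isHom_toPairOperad_iff]

end Agree

end IteratedMonoidal

theorem mainTheorem3 {n : ℕ} {V : Type u} [Category.{v} V] (M : IteratedMonoidal n V)
    [HasCoproducts.{0} V] (hM : M.PreservesCoproducts) (m : ℕ) (hm : 2 ≤ m) (hn : m ≤ n) :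
    -- every expanded operad is a monoid, with multiplication `γ^{m-1,m}`
    (∀ (C : ℕ → V) (O : M.ExpandedOperad m C),
      ∃! N : M.CondensedOperad hM m hm hn C, M.Agree O N) ∧
    -- every monoid arises, from exactly one expanded operad whose `γ^{pq}` are compatible
    (∀ (C : ℕ → V) (N : M.CondensedOperad hM m hm hn C),
      ∃! O : M.ExpandedOperad m C, O.Compatible ∧ M.Agree O N) ∧
    -- under this correspondence the morphisms are the same
    (∀ (C D : ℕ → V) (O : M.ExpandedOperad m C) (O' : M.ExpandedOperad m D)
      (N : M.CondensedOperad hM m hm hn C) (N' : M.CondensedOperad hM m hm hn D)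
      (f : ∀ j, C j ⟶ D j), O.Compatible → O'.Compatible → M.Agree O N → M.Agree O' N' →
        (O.IsHom O' f ↔ N.IsHom N' f)) ∧
    -- a monoid for `⊗^{m-1,m}` gives one for each `⊗^{ps}` with `p < s ≤ m`
    (∀ (C : ℕ → V) (N : M.CondensedOperad hM m hm hn C) (p s : Fin n) (hps : p < s)
      (hs : s ≤ IteratedMonoidal.upper m hm hn),
      ∃! N' : M.ColMonoid hM p s hps C, N'.BuiltFrom (IteratedMonoidal.le_lower hps hs) hs N) ∧
    -- in particular, an `m`-fold operad is an `(m - 1)`-fold operad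
    (∀ (h3 : 2 ≤ m - 1) (C : ℕ → V) (N : M.CondensedOperad hM m hm hn C),
      ∃! N' : M.CondensedOperad hM (m - 1) h3 ((Nat.sub_le m 1).trans hn) C,
        N'.BuiltFrom (Fin.mk_le_mk.mpr (Nat.sub_le_sub_right (Nat.sub_le m 1) 2))
          (Fin.mk_le_mk.mpr (Nat.sub_le_sub_right (Nat.sub_le m 1) 1)) N) := by
  exact ⟨fun _ O => IteratedMonoidal.existsUnique_agree O,
    fun _ N => IteratedMonoidal.existsUnique_compatible_agree N,
    fun _ _ _ _ _ _ _ hO hO' h h' => h.isHom_iff h' hO hO',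
    fun _ N _ _ hps _ => N.existsUnique_builtFrom hps _ _,
    fun h3 _ N =>
      N.existsUnique_builtFrom (IteratedMonoidal.lower_lt_upper (m - 1) h3 _) _ _⟩
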